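/- **Setting.** Let $k$ be a field, $R=k[x_1,\dots,x_n]$, $\mathcal M$ the set of monomials of $R$, and $\le_m$ an admissible monomial order (a linear order on $\mathcal M$ with $1\le_m t$ for all $t$, preserved by multiplication; it is a well-order). For $d\ge 0$ let $\mathcal M_d=\{t\mathbf e_i : t\in\mathcal M,\ 1\le i\le d\}$ be the set of module monomials of $R^d$; $t\mathbf e_i$ divides $t'\mathbf e_j$ if $i=j$ and $t\mid t'$. An *admissible module order* on $\mathcal M_d$ is a linear order $\le_s$ with $\mathbf e_i\le_s t\mathbf e_i$, and such that $t_1\mathbf e_i\le_s t_2\mathbf e_j$ implies $t\,t_1\mathbf e_i\le_s t\,t_2\mathbf e_j$ for all $i,j$ and all monomials $t$. It is *compatible* with $\le_m$ if $\sigma\mathbf e_i\le_s\tau\mathbf e_i\iff\sigma\le_m\tau$. For $f_1,\dots,f_d\in R$, sig-polynomials are pairs $(\mathbf u,p)\in R^d\times R$ with $\sum_i u_if_i=p$. The signature of $(\mathbf u,p)$ with $\mathbf u\ne 0$ is the $\le_s$-largest module monomial $t\mathbf e_i$ of $\mathbf u$, and $i$ is its index; $lm(p)$ and $lc(p)$ are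 the leading monomial and coefficient of $p\neq0$ for $\le_m$. * *tm-reduction.* $(\mathbf u,p)$, $p\ne0$, is tm-reduced in one step by a set $B$ to $(\mathbf u,p)-\frac{lc(p)}{lc(p')}\,t\,(\mathbf u',p')$ if $(\mathbf u',p')\in B$, $p'\neq 0$, $t\in\mathcal M$, $t\,lm(p')=lm(p)$ and $t\cdot\mathrm{sig}(\mathbf u',p')<_s\mathrm{sig}(\mathbf u,p)$. * *ts-rewritable.* $(\mathbf u,p)$, $p\neq0$, is ts-rewritable by $B$ if for some $(\mathbf u',p')\in B$ with $\mathbf u'\ne 0$ and some $t\in\mathcal M$, $t\cdot\mathrm{sig}(\mathbf u',p')=\mathrm{sig}(\mathbf u,p)$ and ($p'=0$ or $t\,lm(p')<_m lm(p)$). * *J-pair.* For $sp_1=(\mathbf u_1,p_1)$, $sp_2=(\mathbf u_2,p_2)$ with $p_1,p_2\ne0$ put $m_i=\mathrm{lcm}(lm(p_1),lm(p_2))/lm(p_i)$. If $m_1\mathrm{sig}(sp_1)>_s m_2\mathrm{sig}(sp_2)$, the J-pair of $sp_1$ and $sp_2$ is $m_1sp_1$, with multiplier $m_1$ and first component $sp_1$;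 symmetrically if $<_s$; in case of equality there is none. * *F5-rewritable.* A J-pair $cp$ is F5-rewritable by a list $\mathcal{SG}'$ if the last element of the list whose signature divides $\mathrm{sig}(cp)$ exists and is not the first component of $cp$. **The F5B algorithm.** Input: a finite list $F$ of polynomials of $R$, $\le_m$, and for each $d$ an admissible module order on $\mathcal M_d$ compatible with $\le_m$ (the one used is that for the number $d$ of polynomials left after interreduction). 1. Interreduce $F$: as long as possible, remove a zero entry, or replace an entry $f$, one of whose monomials $a$ is divisible by $lm(g)$ for another nonzero entry $g$, by $f-\frac{c}{lc(g)}\frac{a}{lm(g)}g$, where $c$ is the coefficient of $a$ in $f$. Sort the result $f_1,\dots,f_d$ by ascending leading monomials and put $F_i=(\mathbf e_i,f_i)$. 2. Let $CPs$ be the set of J-pairs of $F_i,F_j$ ($i<j$), $\mathcal{SG}'$ the list $F_1,\dots,F_d$, and $PSyz=\{(f_i\mathbf e_j-f_j\mathbf e_i,0) : i<j\}$. 3. While $CPs\neq\emptyset$: remove from $CPs$ an element $cp$ of $\le_s$-smallest signature. If $cp$ is neither ts-rewritable by $PSyz$ nor F5-rewritable by $\mathcal{SG}'$, tm-reduce $cp$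 by $\mathcal{SG}'$ repeatedly until no tm-reduction is possible, with result $sp=(\mathbf u,g)$, and insert $sp$ into $\mathcal{SG}'$ directly after the last element of the same index. If moreover $g\ne0$, then * add to $CPs$ the J-pairs of $sp$ with the elements $(\mathbf u_l,g_l)\neq sp$ of $\mathcal{SG}'$, $g_l\neq0$, and of all J-pairs in $CPs$ with the same signature keep only the one whose first component comes last in $\mathcal{SG}'$; * add to $PSyz$ the syzygies $(g\mathbf u_l-g_l\mathbf u,0)$ for $(\mathbf u_l,g_l)\in\mathcal{SG}'$, $g_l\ne0$, and discard from $PSyz$ zero and elements whose signature is divisible by that of another element of $PSyz$ (keeping one of those of equal signature). 4. Return $\{g : (\mathbf u,g)\in\mathcal{SG}',\ g\ne0\}$. **Theorem.** For every field $k$, every $n$, every admissible monomial order, every compatible choice of admissible module orders and every finite list $F$ of polynomials in $R$, and however the choices left open above (which interreduction step, which tm-reduction step, which syzygies are discarded) are made, the F5B algorithm terminates: there is no infinite run (each single interreduction step, each single tm-reduction step and each pass through the loop counting as steps), and a run that cannot be continued has returned an output. Every output is a Gröbner basis of the ideal $\langle F\rangle$ with respect to $\le_m$, i.e. a finite set of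 nonzero elements of $\langle F\rangle$ such that the leading monomial of every nonzero element of $\langle F\rangle$ is divisible by the leading monomial of one of them. -/

import Mathlib

open MvPolynomial

namespace F5B

/-! ### Monomials and signatures -/

/-- Exponent vectors of the monomials in `n` variables. -/
abbrev Mon (n : ℕ) : Type := Fin n →₀ ℕ

/-- Module monomials: the pair `(i, a)` stands for `x ^ a • e_i`. -/
abbrev Sgn (n d : ℕ) : Type := Fin d × Mon n

/-- The product of the monomial `x ^ t` and a module monomial. -/
noncomputable def Sgn.shift {n d : ℕ} (t : Mon n) (s : Sgn n d) : Sgn n d := (s.1, t + s.2)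

/-- Divisibility of module monomials. -/
def Sgn.Divides {n d : ℕ} (s s' : Sgn n d) : Prop := s.1 = s'.1 ∧ s.2 ≤ s'.2

/-- An admissible module order: a linear order on the module monomials for which
`e_i ≤ x ^ a • e_i`, and which is preserved by multiplication with monomials. -/
structure ModuleOrder (n d : ℕ) where
  le : Sgn n d → Sgn n d → Prop
  le_refl : ∀ s, le s s
  le_trans : ∀ s s' s'', le s s' → le s' s'' → le s s''
  le_antisymm : ∀ s s', le s s' → le s' s → s = s'
  le_total : ∀ s s', le s s' ∨ le s' s
  unit_le : ∀ (i : Fin d) (a : Mon n), le (i, 0) (i, a)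
  shift_le : ∀ (t : Mon n) (s s' : Sgn n d), le s s' → le (s.shift t) (s'.shift t)

/-- The strict part of a module order. -/
def ModuleOrder.lt {n d : ℕ} (O : ModuleOrder n d) (s s' : Sgn n d) : Prop :=
  O.le s s' ∧ ¬ O.le s' s

/-- Compatibility of a module order with a monomial order. -/
def ModuleOrder.Compatible {n d : ℕ} (O : ModuleOrder n d) (m : MonomialOrder (Fin n)) : Prop :=
  ∀ (i : Fin d) (a b : Mon n), O.le (i, a) (i, b) ↔ m.toSyn a ≤ m.toSyn b

/-! ### Sig-polynomials -/

section SigPolynomials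

variable {k : Type*} [Field k] {n d : ℕ}

/-- Pairs `(u, p)` of a vector of polynomials and a polynomial. -/
abbrev SigPoly (k : Type*) [Field k] (n d : ℕ) : Type _ :=
  (Fin d → MvPolynomial (Fin n) k) × MvPolynomial (Fin n) k

/-- `s` is the signature of `(u, p)`, that is, the largest module monomial occurring in `u`.
A pair with `u = 0` has no signature. -/
def HasSig (O : ModuleOrder n d) (sp : SigPoly k n d) (s : Sgn n d) : Prop :=
  coeff s.2 (sp.1 s.1) ≠ 0 ∧ ∀ s' : Sgn n d, coeff s'.2 (sp.1 s'.1) ≠ 0 → O.le s' s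

/-- `i` is the index of `(u, p)`, that is, the position of its signature. -/
def HasIdx (O : ModuleOrder n d) (sp : SigPoly k n d) (i : Fin d) : Prop :=
  ∃ a : Mon n, HasSig O sp (i, a)

/-- `sp'` results from `sp` by one tm-reduction by an element of `B`: the leading term of the
polynomial part is cancelled by a multiple of an element of `B` whose signature is smaller. -/
def TmReduces (m : MonomialOrder (Fin n)) (O : ModuleOrder n d) (B : Set (SigPoly k n d))
    (sp sp' : SigPoly k n d) : Prop :=
  sp.2 ≠ 0 ∧ ∃ b ∈ B, b.2 ≠ 0 ∧ ∃ (t : Mon n) (s s' : Sgn n d),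
    HasSig O sp s ∧ HasSig O b s' ∧ t + m.degree b.2 = m.degree sp.2 ∧ O.lt (s'.shift t) s ∧
    sp' = sp - monomial t (m.leadingCoeff sp.2 / m.leadingCoeff b.2) • b

/-- `sp` is ts-rewritable by `B`: some element of `B` has a multiple with the signature of `sp`
and a smaller leading monomial, where the leading monomial of a syzygy is smaller than all
monomials. -/
def TsRewritable (m : MonomialOrder (Fin n)) (O : ModuleOrder n d) (B : Set (SigPoly k n d))
    (sp : SigPoly k n d) : Prop :=
  sp.2 ≠ 0 ∧ ∃ b ∈ B, ∃ (t : Mon n) (s s' : Sgn n d),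
    HasSig O sp s ∧ HasSig O b s' ∧ s'.shift t = s ∧
    (b.2 = 0 ∨ m.toSyn (t + m.degree b.2) < m.toSyn (m.degree sp.2))

/-! ### J-pairs -/

/-- A J-pair is recorded as its multiplier together with its first component. -/
abbrev JPair (k : Type*) [Field k] (n d : ℕ) : Type _ := Mon n × SigPoly k n d

/-- The sig-polynomial of a J-pair, that is, the multiplier times the first component. -/
noncomputable def JPair.toSigPoly (cp : JPair k n d) : SigPoly k n d :=
  monomial cp.1 (1 : k) • cp.2

/-- The exponent of `lcm (lm p) (lm q) / lm p`. -/
noncomputable def multiplier (m : MonomialOrder (Fin n)) (p q : MvPolynomial (Fin n) k) : Mon n :=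
  (m.degree p ⊔ m.degree q) - m.degree p

/-- `cp` is the J-pair of `a` and `b`, with first component `a`. -/
def IsJPairFst (m : MonomialOrder (Fin n)) (O : ModuleOrder n d) (a b : SigPoly k n d)
    (cp : JPair k n d) : Prop :=
  a.2 ≠ 0 ∧ b.2 ≠ 0 ∧ cp = (multiplier m a.2 b.2, a) ∧ ∃ s s' : Sgn n d,
    HasSig O a s ∧ HasSig O b s' ∧
    O.lt (s'.shift (multiplier m b.2 a.2)) (s.shift (multiplier m a.2 b.2))

/-- `cp` is the J-pair of `a` and `b`. -/
def IsJPair (m : MonomialOrder (Fin n)) (O : ModuleOrder n d) (a b : SigPoly k n d)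
    (cp : JPair k n d) : Prop :=
  IsJPairFst m O a b cp ∨ IsJPairFst m O b a cp

/-- `cp` is an element of `CPs` of smallest signature. -/
def IsMinJPair (O : ModuleOrder n d) (CPs : Set (JPair k n d)) (cp : JPair k n d) : Prop :=
  cp ∈ CPs ∧ ∃ s, HasSig O cp.toSigPoly s ∧
    ∀ cp' ∈ CPs, ∀ s', HasSig O cp'.toSigPoly s' → O.le s s'

/-- `cp` is F5-rewritable by the list `SG`: the last element of the list whose signature divides
the signature of `cp` is not the first component of `cp`. -/
def F5Rewritable (O : ModuleOrder n d) (SG : List (SigPoly k n d)) (cp : JPair k n d) : Prop :=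
  ∃ (s s' : Sgn n d) (l₁ l₂ : List (SigPoly k n d)) (b : SigPoly k n d),
    HasSig O cp.toSigPoly s ∧ SG = l₁ ++ b :: l₂ ∧ HasSig O b s' ∧ s'.Divides s ∧
    (∀ c ∈ l₂, ∀ s'', HasSig O c s'' → ¬ s''.Divides s) ∧ b ≠ cp.2

/-- For each signature keep only the J-pair whose first component comes last in `SG`. -/
def dedup (O : ModuleOrder n d) (SG : List (SigPoly k n d)) (CPs : Set (JPair k n d)) :
    Set (JPair k n d) :=
  {cp | cp ∈ CPs ∧ ∀ cp' ∈ CPs, ∀ s, HasSig O cp.toSigPoly s → HasSig O cp'.toSigPoly s →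
    ¬ List.Sublist [cp.2, cp'.2] SG}

/-- `SG'` is obtained by inserting `sp` into `SG` after the last element with the same index. -/
def InsertByIndex (O : ModuleOrder n d) (sp : SigPoly k n d) (SG SG' : List (SigPoly k n d)) :
    Prop :=
  ∃ (i : Fin d) (l₁ l₂ : List (SigPoly k n d)) (b : SigPoly k n d),
    HasIdx O sp i ∧ SG = l₁ ++ b :: l₂ ∧ HasIdx O b i ∧ (∀ c ∈ l₂, ¬ HasIdx O c i) ∧
    SG' = l₁ ++ b :: sp :: l₂

/-- The principal syzygy `(p₂ u₁ - p₁ u₂, 0)` of `(u₁, p₁)` and `(u₂, p₂)`. -/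
noncomputable def principalSyzygy (a b : SigPoly k n d) : SigPoly k n d :=
  (b.2 • a.1 - a.2 • b.1, 0)

/-- For sets of syzygies: `P` arises from `N` by discarding zero and the elements that are super
top-reducible (of signature divisible by that of another element), so that every nonzero element
of `N` is super top-reducible by an element of `P`, and no element of `P` by a different one. -/
def SuperReduced (O : ModuleOrder n d) (N P : Set (SigPoly k n d)) : Prop :=
  P ⊆ N ∧ (∀ z ∈ P, z ≠ 0) ∧
  (∀ z ∈ N, z ≠ 0 → ∃ y ∈ P, ∃ s s', HasSig O y s ∧ HasSig O z s' ∧ s.Divides s') ∧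
  (∀ y ∈ P, ∀ z ∈ P, y ≠ z → ∀ s s', HasSig O y s → HasSig O z s' → ¬ s.Divides s')

/-! ### Initial values -/

/-- The sig-polynomial `(e_i, f_i)`. -/
noncomputable def unitSig (f : Fin d → MvPolynomial (Fin n) k) (i : Fin d) : SigPoly k n d :=
  (Pi.single i 1, f i)

noncomputable def initSG (f : Fin d → MvPolynomial (Fin n) k) : List (SigPoly k n d) :=
  List.ofFn (unitSig f)

def initCPs (m : MonomialOrder (Fin n)) (O : ModuleOrder n d)
    (f : Fin d → MvPolynomial (Fin n) k) : Set (JPair k n d) :=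
  {cp | ∃ i j : Fin d, i < j ∧ IsJPair m O (unitSig f i) (unitSig f j) cp}

/-- The pairs `(f_i e_j - f_j e_i, 0)` with `i < j`. -/
def initPSyz (f : Fin d → MvPolynomial (Fin n) k) : Set (SigPoly k n d) :=
  {z | ∃ i j : Fin d, i < j ∧ z = principalSyzygy (unitSig f j) (unitSig f i)}

end SigPolynomials

/-! ### The algorithm -/

section Algorithm

variable {k : Type*} [Field k] {n : ℕ}

/-- One step of the interreduction of a list of polynomials: remove a zero, or cancel one term of
an entry that is divisible by the leading monomial of another entry. -/
inductive InterStep (m : MonomialOrder (Fin n)) :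
    List (MvPolynomial (Fin n) k) → List (MvPolynomial (Fin n) k) → Prop
  | dropZero (L : List (MvPolynomial (Fin n) k)) (i : Fin L.length) (h : L.get i = 0) :
      InterStep m L (L.eraseIdx i)
  | reduce (L : List (MvPolynomial (Fin n) k)) (i j : Fin L.length) (hij : i ≠ j)
      (hj : L.get j ≠ 0) (a : Mon n) (ha : coeff a (L.get i) ≠ 0)
      (hdvd : m.degree (L.get j) ≤ a) :
      InterStep m L (L.set i (L.get i -
        monomial (a - m.degree (L.get j)) (coeff a (L.get i) / m.leadingCoeff (L.get j)) *
          L.get j))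

/-- `L'` is the list `L` sorted by ascending leading monomials. -/
def SortedOf (m : MonomialOrder (Fin n)) (L L' : List (MvPolynomial (Fin n) k)) : Prop :=
  L'.Perm L ∧ L'.Pairwise fun p q => m.toSyn (m.degree p) ≤ m.toSyn (m.degree q)

/-- The states of the algorithm: interreducing the input, at the head of the while-loop,
tm-reducing the sig-polynomial `sp`, or halted with an output. -/
inductive State (k : Type*) [Field k] (n : ℕ) : Type _
  | interreducing (L : List (MvPolynomial (Fin n) k)) : State k n
  | loop {d : ℕ} (CPs : Set (JPair k n d)) (SG : List (SigPoly k n d))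
      (PSyz : Set (SigPoly k n d)) : State k n
  | reducing {d : ℕ} (CPs : Set (JPair k n d)) (SG : List (SigPoly k n d))
      (PSyz : Set (SigPoly k n d)) (sp : SigPoly k n d) : State k n
  | output (G : Set (MvPolynomial (Fin n) k)) : State k n

/-- One step of the algorithm. The number of polynomials is known only after the interreduction,
so a module order `O d` is given for each `d`. -/
inductive Step (m : MonomialOrder (Fin n)) (O : ∀ d : ℕ, ModuleOrder n d) :
    State k n → State k n → Prop
  | interreduce (L L' : List (MvPolynomial (Fin n) k)) (h : InterStep m L L') :
      Step m O (.interreducing L) (.interreducing L')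
  | init (L L' : List (MvPolynomial (Fin n) k)) (hL : ∀ L'', ¬ InterStep m L L'')
      (hsort : SortedOf m L L') :
      Step m O (.interreducing L)
        (.loop (initCPs m (O L'.length) L'.get) (initSG L'.get) (initPSyz L'.get))
  | discard {d : ℕ} (CPs : Set (JPair k n d)) (SG : List (SigPoly k n d))
      (PSyz : Set (SigPoly k n d)) (cp : JPair k n d) (hmin : IsMinJPair (O d) CPs cp)
      (h : TsRewritable m (O d) PSyz cp.toSigPoly ∨ F5Rewritable (O d) SG cp) :
      Step m O (.loop CPs SG PSyz) (.loop (CPs \ {cp}) SG PSyz)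
  | select {d : ℕ} (CPs : Set (JPair k n d)) (SG : List (SigPoly k n d))
      (PSyz : Set (SigPoly k n d)) (cp : JPair k n d) (hmin : IsMinJPair (O d) CPs cp)
      (hts : ¬ TsRewritable m (O d) PSyz cp.toSigPoly) (hF5 : ¬ F5Rewritable (O d) SG cp) :
      Step m O (.loop CPs SG PSyz) (.reducing (CPs \ {cp}) SG PSyz cp.toSigPoly)
  | tmReduce {d : ℕ} (CPs : Set (JPair k n d)) (SG : List (SigPoly k n d))
      (PSyz : Set (SigPoly k n d)) (sp sp' : SigPoly k n d)
      (h : TmReduces m (O d) {b | b ∈ SG} sp sp') :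
      Step m O (.reducing CPs SG PSyz sp) (.reducing CPs SG PSyz sp')
  | insertSyzygy {d : ℕ} (CPs : Set (JPair k n d)) (SG SG' : List (SigPoly k n d))
      (PSyz : Set (SigPoly k n d)) (sp : SigPoly k n d)
      (hsp : sp.2 = 0) (hins : InsertByIndex (O d) sp SG SG') :
      Step m O (.reducing CPs SG PSyz sp) (.loop CPs SG' PSyz)
  | insert {d : ℕ} (CPs : Set (JPair k n d)) (SG SG' : List (SigPoly k n d))
      (PSyz PSyz' : Set (SigPoly k n d)) (sp : SigPoly k n d)
      (hirr : ∀ sp', ¬ TmReduces m (O d) {b | b ∈ SG} sp sp')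
      (hsp : sp.2 ≠ 0) (hins : InsertByIndex (O d) sp SG SG')
      (hP : SuperReduced (O d)
        (PSyz ∪ {z | ∃ b ∈ SG', b.2 ≠ 0 ∧ z = principalSyzygy b sp}) PSyz') :
      Step m O (.reducing CPs SG PSyz sp)
        (.loop
          (dedup (O d) SG' (CPs ∪ {cp | ∃ b ∈ SG', b.2 ≠ 0 ∧ b ≠ sp ∧ IsJPair m (O d) sp b cp}))
          SG' PSyz')
  | halt {d : ℕ} (SG : List (SigPoly k n d)) (PSyz : Set (SigPoly k n d)) :
      Step m O (.loop ∅ SG PSyz) (.output {g | ∃ b ∈ SG, b.2 ≠ 0 ∧ g = b.2})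

/-- `G` is a Gröbner basis of the ideal `I`: a finite set of nonzero elements of `I` such that the
leading monomial of every nonzero element of `I` is divisible by that of an element of `G`. -/
def IsGroebnerBasis (m : MonomialOrder (Fin n)) (G : Set (MvPolynomial (Fin n) k))
    (I : Ideal (MvPolynomial (Fin n) k)) : Prop :=
  G.Finite ∧ (∀ g ∈ G, g ≠ 0 ∧ g ∈ I) ∧
    ∀ p ∈ I, p ≠ 0 → ∃ g ∈ G, m.degree g ≤ m.degree p

end Algorithm

end F5B

/-! Correctness. Call a J-pair superfluous if its signature is a multiple of a syzygy signature, or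
of the signature of a list element standing after its first component; later insertions preserve
this. Suppose all J-pairs whose signatures divide `S` are superfluous and `S` is not a multiple of a
syzygy signature. Then the last list element whose signature divides `S` has a multiple of signature
`S` that is not tm-reducible: a reduction would come from a J-pair and so produce a still later
element (`rewritten_of_superfluous`). If this holds for all signatures up to `S`, subtracting such
multiples lowers signatures, and well-founded induction shows that leading monomials at signature
`S` are divisible by leading monomials from the list (`covers_of_rewritten`). The loop keeps every
J-pair pending or superfluous (`LoopInv`), so an empty `CPs` means a Gröbner basis.

Termination. The same argument below the current signature `T` (`RedInv.covers`) shows: if the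
signature and the leading monomial of an earlier element both divide those of a newly inserted one,
the two quotients agree (`RedInv.ratio_eq`). Moreover the ratio of signature to leading monomial of
the new element strictly exceeds the ratios of both elements of its J-pair (`RedInv.fresh`). By
Dickson's lemma finitely many ratios occur, and induction along them shows that each is taken
finitely often (`finite_of_ratio`). So nonzero polynomials are inserted only finitely often, and all
other steps lower `State.rank`. Interreduction stops by the multiset order on monomials
(`wellFounded_interStep`). -/

namespace F5B

/-! ### Module orders -/

section Order

variable {n d : ℕ}

lemma Sgn.shift_shift (t t' : Mon n) (s : Sgn n d) : (s.shift t').shift t = s.shift (t + t') := by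
  simp [Sgn.shift, add_assoc]

lemma Sgn.shift_comm (t t' : Mon n) (s : Sgn n d) :
    (s.shift t').shift t = (s.shift t).shift t' := by
  rw [Sgn.shift_shift, Sgn.shift_shift, add_comm]

@[simp] lemma Sgn.shift_zero (s : Sgn n d) : s.shift 0 = s := by simp [Sgn.shift]

lemma Sgn.shift_injective (t : Mon n) {s s' : Sgn n d} (h : s.shift t = s'.shift t) : s = s' := by
  simp only [Sgn.shift, Prod.mk.injEq, add_right_inj] at h
  exact Prod.ext h.1 h.2

lemma Sgn.shift_cancel {t t' : Mon n} {s : Sgn n d} (h : s.shift t = s.shift t') : t = t' := by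
  simpa [Sgn.shift] using h

lemma Sgn.divides_iff {s s' : Sgn n d} : s.Divides s' ↔ ∃ t, s.shift t = s' := by
  constructor
  · rintro ⟨h1, h2⟩
    exact ⟨s'.2 - s.2, Prod.ext h1 (tsub_add_cancel_of_le h2)⟩
  · rintro ⟨t, rfl⟩
    exact ⟨rfl, le_add_self⟩

lemma Sgn.divides_shift (t : Mon n) (s : Sgn n d) : s.Divides (s.shift t) :=
  Sgn.divides_iff.2 ⟨t, rfl⟩

lemma Sgn.Divides.refl (s : Sgn n d) : s.Divides s := ⟨rfl, le_rfl⟩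

lemma Sgn.Divides.trans {s s' s'' : Sgn n d} (h : s.Divides s') (h' : s'.Divides s'') :
    s.Divides s'' := ⟨h.1.trans h'.1, h.2.trans h'.2⟩

instance : IsPreorder (Sgn n d) Sgn.Divides where
  refl := Sgn.Divides.refl
  trans _ _ _ := Sgn.Divides.trans

/-- Dickson's lemma for modules: there are finitely many positions, and exponent vectors are
well-quasi-ordered. -/
lemma Sgn.wellQuasiOrdered_divides : WellQuasiOrdered (Sgn.Divides (n := n) (d := d)) :=
  (Finite.wellQuasiOrdered (α := Fin d) (· = ·)).prod (wellQuasiOrdered_le (α := Mon n))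

namespace ModuleOrder

variable {O : ModuleOrder n d} {s s' s'' : Sgn n d}

lemma lt_iff_not_le : O.lt s s' ↔ ¬ O.le s' s :=
  ⟨fun h => h.2, fun h => ⟨(O.le_total s s').resolve_right h, h⟩⟩

lemma not_lt : ¬ O.lt s s' ↔ O.le s' s := by rw [lt_iff_not_le, not_not]

lemma lt_irrefl (s : Sgn n d) : ¬ O.lt s s := fun h => h.2 h.1

lemma lt_of_le_of_lt (h : O.le s s') (h' : O.lt s' s'') : O.lt s s'' :=
  ⟨O.le_trans _ _ _ h h'.1, fun h2 => h'.2 (O.le_trans _ _ _ h2 h)⟩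

lemma lt_trans (h : O.lt s s') (h' : O.lt s' s'') : O.lt s s'' := lt_of_le_of_lt h.1 h'

lemma lt_of_le_of_ne (h : O.le s s') (h' : s ≠ s') : O.lt s s' :=
  ⟨h, fun h2 => h' (O.le_antisymm _ _ h h2)⟩

lemma lt_shift_iff (t : Mon n) : O.lt (s.shift t) (s'.shift t) ↔ O.lt s s' := by
  constructor
  · intro h
    rw [lt_iff_not_le]
    exact fun h' => h.2 (O.shift_le t _ _ h')
  · intro h
    refine lt_of_le_of_ne (O.shift_le t _ _ h.1) fun h' => ?_
    rw [Sgn.shift_injective t h'] at h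
    exact lt_irrefl _ h

lemma le_shift (t : Mon n) (s : Sgn n d) : O.le s (s.shift t) := by
  have h := O.shift_le s.2 _ _ (O.unit_le s.1 t)
  simpa [Sgn.shift, add_comm] using h

lemma lt_shift_self {t : Mon n} (ht : t ≠ 0) (s : Sgn n d) : O.lt s (s.shift t) := by
  refine lt_of_le_of_ne (le_shift t s) fun h => ht ?_
  exact (Sgn.shift_cancel ((Sgn.shift_zero s).trans h)).symm

lemma le_of_divides (h : s.Divides s') : O.le s s' := by
  obtain ⟨t, rfl⟩ := Sgn.divides_iff.1 h
  exact le_shift t s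

lemma Compatible.shift_lt {m : MonomialOrder (Fin n)} (hO : O.Compatible m) {a b : Mon n}
    (h : m.toSyn a < m.toSyn b) (s : Sgn n d) : O.lt (s.shift a) (s.shift b) := by
  rw [lt_iff_not_le]
  intro h'
  have := (hO s.1 _ _).1 h'
  rw [map_add, map_add, add_le_add_iff_right] at this
  exact absurd h this.not_gt

-- Divisibility implies `O.le`, so an infinite descending chain would contradict Dickson's lemma.
variable (O) in
theorem wellFounded_lt : WellFounded O.lt := by
  have : IsStrictOrder (Sgn n d) O.lt :=
    { irrefl := lt_irrefl, trans := fun _ _ _ => lt_trans }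
  rw [RelEmbedding.wellFounded_iff_isEmpty]
  refine ⟨fun f => ?_⟩
  obtain ⟨i, j, hij, h⟩ := Sgn.wellQuasiOrdered_divides (n := n) (d := d) f
  exact (f.map_rel_iff.2 hij).2 (le_of_divides h)

variable (O) in
lemma exists_minimal (A : Set (Sgn n d)) (hA : A.Nonempty) : ∃ s ∈ A, ∀ s' ∈ A, O.le s s' := by
  obtain ⟨s, hs, h⟩ := (wellFounded_lt O).has_min A hA
  exact ⟨s, hs, fun s' hs' => not_lt.1 (h s' hs')⟩

variable (O) in
lemma exists_maximal (A : Finset (Sgn n d)) (hA : A.Nonempty) :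
    ∃ s ∈ A, ∀ s' ∈ A, O.le s' s := by
  classical
  induction hA using Finset.Nonempty.cons_induction with
  | singleton a => exact ⟨a, by simp, by simpa using O.le_refl a⟩
  | cons a A ha hA ih =>
    obtain ⟨s, hs, h⟩ := ih
    rcases O.le_total a s with h' | h'
    · refine ⟨s, by simp [hs], ?_⟩
      simpa [h'] using fun i b hb => h (i, b) hb
    · refine ⟨a, by simp, ?_⟩
      simpa [O.le_refl] using fun i b hb => O.le_trans _ _ _ (h (i, b) hb) h'

end ModuleOrder

end Order

/-! ### Signatures -/

section Signatures

variable {k : Type*} [Field k] {n d : ℕ} {O : ModuleOrder n d} {m : MonomialOrder (Fin n)}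

lemma HasSig.unique {sp : SigPoly k n d} {s s' : Sgn n d} (h : HasSig O sp s)
    (h' : HasSig O sp s') : s = s' :=
  O.le_antisymm _ _ (h'.2 _ h.1) (h.2 _ h'.1)

lemma exists_hasSig (O : ModuleOrder n d) {sp : SigPoly k n d} (h : sp.1 ≠ 0) :
    ∃ s, HasSig O sp s := by
  classical
  let A : Finset (Sgn n d) :=
    Finset.univ.biUnion fun i => (sp.1 i).support.image fun a => (i, a)
  have hA : ∀ s : Sgn n d, s ∈ A ↔ coeff s.2 (sp.1 s.1) ≠ 0 := by
    rintro ⟨i, a⟩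
    simp [A]
  obtain ⟨i, hi⟩ := Function.ne_iff.1 h
  obtain ⟨a, ha⟩ := MvPolynomial.ne_zero_iff.1 hi
  obtain ⟨s, hs, hmax⟩ := O.exists_maximal A ⟨(i, a), (hA _).2 ha⟩
  exact ⟨s, (hA s).1 hs, fun s' hs' => hmax s' ((hA s').2 hs')⟩

lemma HasSig.monomial_smul {sp : SigPoly k n d} {s : Sgn n d} (h : HasSig O sp s) (t : Mon n)
    {c : k} (hc : c ≠ 0) : HasSig O (monomial t c • sp) (s.shift t) := by
  constructor
  · simp only [Sgn.shift, Prod.smul_fst, Pi.smul_apply, smul_eq_mul, coeff_monomial_mul]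
    exact mul_ne_zero hc h.1
  · rintro ⟨i, a⟩ hs
    simp only [Prod.smul_fst, Pi.smul_apply, smul_eq_mul, coeff_monomial_mul'] at hs
    split_ifs at hs with hle
    · have := O.shift_le t _ _ (h.2 (i, a - t) (right_ne_zero_of_mul hs))
      rwa [Sgn.shift, add_tsub_cancel_of_le hle] at this
    · exact absurd rfl hs

lemma HasSig.of_monomial_smul {sp : SigPoly k n d} {t : Mon n} {c : k} (hc : c ≠ 0) {s : Sgn n d}
    (h : HasSig O (monomial t c • sp) s) : ∃ s', HasSig O sp s' ∧ s = s'.shift t := by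
  have h0 : sp.1 ≠ 0 := by
    rintro h0
    apply h.1
    simp [h0]
  obtain ⟨s', hs'⟩ := exists_hasSig O h0
  exact ⟨s', hs', h.unique (hs'.monomial_smul t hc)⟩

/-- Every module monomial of `b` is strictly below `s`, so the top term of `a` cannot cancel. This
is why tm-reduction keeps the signature. -/
lemma HasSig.sub_of_lt {a b : SigPoly k n d} {s s' : Sgn n d} (ha : HasSig O a s)
    (hb : HasSig O b s') (h : O.lt s' s) : HasSig O (a - b) s := by
  have hb0 : ∀ r : Sgn n d, O.lt s' r → coeff r.2 (b.1 r.1) = 0 := fun r hr => by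
    by_contra hne
    exact hr.2 (hb.2 r hne)
  constructor
  · simpa [hb0 s h] using ha.1
  · intro r hr
    by_contra hle
    rw [← ModuleOrder.lt_iff_not_le] at hle
    apply hr
    have h1 : coeff r.2 (a.1 r.1) = 0 := by
      by_contra hne
      exact hle.2 (ha.2 r hne)
    simp [h1, hb0 r (ModuleOrder.lt_trans h hle)]

/-- Cancelling the leading terms of the vector parts yields a smaller signature. -/
lemma HasSig.exists_sub_lt {a b : SigPoly k n d} {s : Sgn n d} (ha : HasSig O a s)
    (hb : HasSig O b s) : ∃ c : k, c ≠ 0 ∧ ((a - monomial (0 : Mon n) c • b).1 = 0 ∨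
      ∃ s', HasSig O (a - monomial (0 : Mon n) c • b) s' ∧ O.lt s' s) := by
  -- The quotient of the two coefficients at `s`, so that the terms there cancel.
  refine ⟨coeff s.2 (a.1 s.1) / coeff s.2 (b.1 s.1), div_ne_zero ha.1 hb.1, ?_⟩
  set c := coeff s.2 (a.1 s.1) / coeff s.2 (b.1 s.1) with hc
  by_cases h0 : (a - monomial (0 : Mon n) c • b).1 = 0
  · exact Or.inl h0
  obtain ⟨s', hs'⟩ := exists_hasSig O h0
  refine Or.inr ⟨s', hs', ?_⟩
  have hcoeff : ∀ r : Sgn n d, coeff r.2 ((a - monomial (0 : Mon n) c • b).1 r.1) =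
      coeff r.2 (a.1 r.1) - c * coeff r.2 (b.1 r.1) := by
    intro r
    simp [← C_apply, coeff_C_mul]
  refine ModuleOrder.lt_of_le_of_ne ?_ ?_
  · have := hs'.1
    rw [hcoeff] at this
    by_cases h1 : coeff s'.2 (a.1 s'.1) = 0
    · rw [h1, zero_sub, neg_ne_zero] at this
      exact hb.2 _ (right_ne_zero_of_mul this)
    · exact ha.2 _ h1
  · rintro rfl
    apply hs'.1
    rw [hcoeff, hc, div_mul_cancel₀ _ hb.1, sub_self]

/-! ### Leading monomials -/

lemma degree_monomial_mul {t : Mon n} {c : k} (hc : c ≠ 0) {p : MvPolynomial (Fin n) k}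
    (hp : p ≠ 0) : m.degree (monomial t c * p) = t + m.degree p := by
  classical
  rw [m.degree_mul (by simpa using hc) hp, m.degree_monomial, if_neg hc]

/-- The leading monomial of a polynomial in the order of `m`, with `⊥` for the zero polynomial. -/
noncomputable def leadSyn (m : MonomialOrder (Fin n)) (p : MvPolynomial (Fin n) k) :
    WithBot m.syn := m.toWithBotSyn (m.withBotDegree p)

lemma leadSyn_zero : leadSyn m (0 : MvPolynomial (Fin n) k) = ⊥ := rfl

lemma leadSyn_of_ne_zero {p : MvPolynomial (Fin n) k} (hp : p ≠ 0) :
    leadSyn m p = (m.toSyn (m.degree p) : WithBot m.syn) := by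
  rw [leadSyn, (m.withBotDegree_eq_coe_degree_iff p).2 hp]
  rfl

lemma leadSyn_sub_lt {p q : MvPolynomial (Fin n) k} (hp : p ≠ 0) (hq : q ≠ 0) {t : Mon n}
    (h : t + m.degree q = m.degree p) :
    leadSyn m (p - monomial t (m.leadingCoeff p / m.leadingCoeff q) * q) < leadSyn m p := by
  have hlp := m.leadingCoeff_ne_zero_iff.2 hp
  have hlq := m.leadingCoeff_ne_zero_iff.2 hq
  set r := monomial t (m.leadingCoeff p / m.leadingCoeff q) * q with hr
  have hdeg : m.degree r = m.degree p := by
    rw [hr, degree_monomial_mul (div_ne_zero hlp hlq) hq, h]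
  have hcoeff : coeff (m.degree p) (p - r) = 0 := by
    rw [coeff_sub, hr, ← h, coeff_monomial_mul, h]
    change m.leadingCoeff p - m.leadingCoeff p / m.leadingCoeff q * m.leadingCoeff q = 0
    rw [div_mul_cancel₀ _ hlq, sub_self]
  rw [leadSyn_of_ne_zero hp]
  by_cases h0 : p - r = 0
  · rw [h0, leadSyn_zero]
    exact WithBot.bot_lt_coe _
  · rw [leadSyn_of_ne_zero h0, WithBot.coe_lt_coe]
    refine lt_of_le_of_ne ?_ fun heq => ?_
    · have := m.degree_sub_le (f := p) (g := r)
      rwa [hdeg, sup_idem] at this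
    · rw [← m.toSyn.injective heq] at hcoeff
      exact (m.coeff_degree_ne_zero_iff.2 h0) hcoeff

end Signatures

section Cover

variable {k : Type*} [Field k] {n d : ℕ} {O : ModuleOrder n d} {m : MonomialOrder (Fin n)}
  {f : Fin d → MvPolynomial (Fin n) k}

/-! ### Sig-polynomials of a given family -/

/-- `(u, p)` satisfies `∑ u_i f_i = p`. -/
def Valid (f : Fin d → MvPolynomial (Fin n) k) (sp : SigPoly k n d) : Prop :=
  ∑ i, sp.1 i * f i = sp.2

lemma Valid.sub {a b : SigPoly k n d} (ha : Valid f a) (hb : Valid f b) : Valid f (a - b) := by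
  simp only [Valid, Prod.fst_sub, Prod.snd_sub, Pi.sub_apply, sub_mul, Finset.sum_sub_distrib] at *
  rw [ha, hb]

lemma Valid.smul {a : SigPoly k n d} (ha : Valid f a) (q : MvPolynomial (Fin n) k) :
    Valid f (q • a) := by
  simp only [Valid, Prod.smul_fst, Prod.smul_snd, Pi.smul_apply, smul_eq_mul, mul_assoc,
    ← Finset.mul_sum] at *
  rw [ha]

lemma valid_unitSig (f : Fin d → MvPolynomial (Fin n) k) (i : Fin d) : Valid f (unitSig f i) := by
  simp [Valid, unitSig, Pi.single_apply]

lemma Valid.principalSyzygy {a b : SigPoly k n d} (ha : Valid f a) (hb : Valid f b) :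
    Valid f (principalSyzygy a b) := by
  have h := (ha.smul b.2).sub (hb.smul a.2)
  have h2 : b.2 • a - a.2 • b = F5B.principalSyzygy a b := by
    refine Prod.ext rfl ?_
    simp [F5B.principalSyzygy, mul_comm]
  rwa [h2] at h

lemma Valid.snd_mem {a : SigPoly k n d} (ha : Valid f a) : a.2 ∈ Ideal.span (Set.range f) := by
  rw [← ha]
  exact Ideal.sum_mem _ fun i _ =>
    Ideal.mul_mem_left _ _ (Ideal.subset_span (Set.mem_range_self i))

lemma Valid.snd_eq_zero {a : SigPoly k n d} (ha : Valid f a) (h : a.1 = 0) : a.2 = 0 := by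
  rw [← ha, h]
  simp

lemma exists_valid {p : MvPolynomial (Fin n) k} (hp : p ∈ Ideal.span (Set.range f)) :
    ∃ u, Valid f (u, p) :=
  Ideal.mem_span_range_iff_exists_fun.1 hp

lemma hasSig_unitSig (O : ModuleOrder n d) (f : Fin d → MvPolynomial (Fin n) k) (i : Fin d) :
    HasSig O (unitSig f i) (i, 0) := by
  have key : ∀ s : Sgn n d, coeff s.2 ((unitSig f i).1 s.1) ≠ 0 → s = (i, 0) := by
    rintro ⟨j, a⟩ h
    by_cases hj : j = i
    · subst hj
      by_cases ha : 0 = a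
      · rw [← ha]
      · simp [unitSig, coeff_one, ha] at h
    · simp [unitSig, hj] at h
  constructor
  · simp [unitSig]
  · intro s hs
    rw [key s hs]
    exact O.le_refl _

lemma unitSig_injective (f : Fin d → MvPolynomial (Fin n) k) :
    Function.Injective (unitSig f) := fun i j h => by
  by_contra hij
  have := congrFun (congrArg Prod.fst h) i
  simp [unitSig, hij] at this

/-! ### Syzygies and canonical rewriters -/

/-- The module monomial `S` is a multiple of the signature of a syzygy. -/
def SyzSig (O : ModuleOrder n d) (f : Fin d → MvPolynomial (Fin n) k) (S : Sgn n d) : Prop :=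
  ∃ z : SigPoly k n d, Valid f z ∧ z.2 = 0 ∧ ∃ s, HasSig O z s ∧ s.Divides S

lemma SyzSig.of_divides {S S' : Sgn n d} (h : SyzSig O f S) (h' : S.Divides S') :
    SyzSig O f S' := by
  obtain ⟨z, hz, hz2, s, hs, hd⟩ := h
  exact ⟨z, hz, hz2, s, hs, hd.trans h'⟩

/-- Some multiple of an element of `G` of signature `S` is not tm-reducible by `G`, or `S` is the
signature of a syzygy. -/
def Rewritten (m : MonomialOrder (Fin n)) (O : ModuleOrder n d)
    (f : Fin d → MvPolynomial (Fin n) k) (G : Set (SigPoly k n d)) (S : Sgn n d) : Prop :=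
  SyzSig O f S ∨ ∃ c ∈ G, c.2 ≠ 0 ∧ Valid f c ∧ ∃ t s, HasSig O c s ∧ s.shift t = S ∧
    ∀ b ∈ G, b.2 ≠ 0 → ∀ t' s', HasSig O b s' → t' + m.degree b.2 = t + m.degree c.2 →
      ¬ O.lt (s'.shift t') S

/-- Every sig-polynomial of signature `S` with nonzero polynomial part is top-reducible
by `G`. -/
def Covers (m : MonomialOrder (Fin n)) (O : ModuleOrder n d)
    (f : Fin d → MvPolynomial (Fin n) k) (G : Set (SigPoly k n d)) (S : Sgn n d) : Prop :=
  ∀ sp : SigPoly k n d, Valid f sp → HasSig O sp S → sp.2 ≠ 0 →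
    ∃ b ∈ G, b.2 ≠ 0 ∧ ∃ t s, HasSig O b s ∧ t + m.degree b.2 = m.degree sp.2 ∧
      O.le (s.shift t) S

/-- Induction on `S`: subtract a scalar multiple of an element of the same signature (a syzygy
multiple or an irreducible multiple of some `c`), which lowers the signature, and apply the
induction hypothesis to the difference. -/
lemma covers_of_rewritten {G : Set (SigPoly k n d)} (S : Sgn n d)
    (h : ∀ S', O.le S' S → Rewritten m O f G S') : Covers m O f G S := by
  induction S using (ModuleOrder.wellFounded_lt O).induction with
  | _ S ih =>
  intro sp hv hS h0
  have ih' : ∀ sp' : SigPoly k n d, Valid f sp' → ∀ S', HasSig O sp' S' → O.lt S' S → sp'.2 ≠ 0 →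
      ∃ b ∈ G, b.2 ≠ 0 ∧ ∃ t s, HasSig O b s ∧ t + m.degree b.2 = m.degree sp'.2 ∧
        O.lt (s.shift t) S := by
    intro sp' hv' S' hS' hlt h0'
    obtain ⟨b, hb, hb0, t, s, hs, hdeg, hle⟩ :=
      ih S' hlt (fun S'' h'' => h S'' (O.le_trans _ _ _ h'' hlt.1)) sp' hv' hS' h0'
    exact ⟨b, hb, hb0, t, s, hs, hdeg, ModuleOrder.lt_of_le_of_lt hle hlt⟩
  rcases h S (O.le_refl S) with ⟨z, hz, hz2, s, hs, hd⟩ | ⟨c, hc, hc0, hcv, t, s, hs, rfl, hirr⟩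
  -- Subtracting a syzygy leaves the polynomial part unchanged.
  · obtain ⟨t, rfl⟩ := Sgn.divides_iff.1 hd
    obtain ⟨e, he, h'⟩ := hS.exists_sub_lt (hs.monomial_smul t one_ne_zero)
    set sp' := sp - monomial (0 : Mon n) e • monomial t (1 : k) • z with hsp'
    have hv' : Valid f sp' := hv.sub ((hz.smul _).smul _)
    have h2 : sp'.2 = sp.2 := by simp [hsp', hz2]
    rcases h' with h' | ⟨S', hS', hlt⟩
    · exact absurd (h2 ▸ hv'.snd_eq_zero h') h0
    · obtain ⟨b, hb, hb0, t, s, hs, hdeg, hlt'⟩ := ih' sp' hv' S' hS' hlt (h2 ▸ h0)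
      exact ⟨b, hb, hb0, t, s, hs, h2 ▸ hdeg, hlt'.1⟩
  · by_cases heq : m.degree sp.2 = t + m.degree c.2
    · exact ⟨c, hc, hc0, t, s, hs, heq.symm, O.le_refl _⟩
    obtain ⟨e, he, h'⟩ := hS.exists_sub_lt (hs.monomial_smul t one_ne_zero)
    set sp' := sp - monomial (0 : Mon n) e • monomial t (1 : k) • c with hsp'
    have hv' : Valid f sp' := hv.sub ((hcv.smul _).smul _)
    have hdc : m.degree (monomial (0 : Mon n) e * (monomial t (1 : k) * c.2)) =
        t + m.degree c.2 := by
      rw [degree_monomial_mul he (mul_ne_zero (by simp) hc0),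
        degree_monomial_mul one_ne_zero hc0, zero_add]
    have h2 : sp'.2 = sp.2 - monomial (0 : Mon n) e * (monomial t (1 : k) * c.2) := rfl
    have h20 : sp'.2 ≠ 0 := by
      intro hz
      rw [h2, sub_eq_zero] at hz
      rw [hz, hdc] at heq
      exact heq rfl
    rcases h' with h' | ⟨S', hS', hlt⟩
    · exact absurd (hv'.snd_eq_zero h') h20
    obtain ⟨b, hb, hb0, t', s', hs', hdeg, hlt'⟩ := ih' sp' hv' S' hS' hlt h20
    -- The difference has the larger of the two distinct leading monomials. If that is the one of `t
    -- c`, then `b` would tm-reduce `t c`; if it is the one of `sp`, then `b` is the required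
    -- reducer.
    rcases lt_or_gt_of_ne (fun h => heq (m.toSyn.injective h)) with hlt2 | hlt2
    · refine absurd hlt' (hirr b hb hb0 t' s' hs' ?_)
      rw [hdeg, h2, ← neg_sub, m.degree_neg, m.degree_sub_of_lt (by rwa [hdc]), hdc]
    · refine ⟨b, hb, hb0, t', s', hs', ?_, hlt'.1⟩
      rw [hdeg, h2, m.degree_sub_of_lt (by rwa [hdc])]

/-- The last element of a list with a given property. -/
lemma exists_last {α : Type*} {L : List α} (hL : L.Nodup) {P : α → Prop} (h : ∃ x ∈ L, P x) :
    ∃ c ∈ L, P c ∧ ∀ c', [c, c'].Sublist L → ¬ P c' := by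
  induction L with
  | nil => simp at h
  | cons x L ih =>
    rw [List.nodup_cons] at hL
    by_cases h' : ∃ y ∈ L, P y
    · obtain ⟨c, hc, hPc, hlast⟩ := ih hL.2 h'
      refine ⟨c, List.mem_cons_of_mem _ hc, hPc, fun c' hs => ?_⟩
      rcases List.sublist_cons_iff.1 hs with hs | ⟨r, hr, -⟩
      · exact hlast c' hs
      · rw [List.cons.injEq] at hr
        exact absurd (hr.1 ▸ hc) hL.1
    · push Not at h'
      obtain ⟨y, hy, hPy⟩ := h
      obtain rfl : y = x := by
        rcases List.mem_cons.1 hy with rfl | hy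
        · rfl
        · exact absurd hPy (h' y hy)
      refine ⟨y, List.mem_cons_self, hPy, fun c' hs => h' c' ?_⟩
      rcases List.sublist_cons_iff.1 hs with hs | ⟨r, hr, hs⟩
      · exact hs.subset (by simp)
      · rw [List.cons.injEq] at hr
        exact hs.subset (hr.2 ▸ by simp)

/-- The J-pair `cp` is superfluous: its signature is a multiple of that of a syzygy, or of that of
an element of `SG` that comes after the first component of `cp`. -/
def Superfluous (O : ModuleOrder n d) (f : Fin d → MvPolynomial (Fin n) k)
    (SG : List (SigPoly k n d)) (cp : JPair k n d) : Prop :=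
  ∀ s, HasSig O cp.toSigPoly s → SyzSig O f s ∨
    ∃ c, [cp.2, c].Sublist SG ∧ ∃ s', HasSig O c s' ∧ s'.Divides s

lemma Superfluous.mono {SG SG' : List (SigPoly k n d)} {cp : JPair k n d}
    (h : Superfluous O f SG cp) (hsub : SG.Sublist SG') : Superfluous O f SG' cp := by
  intro s hs
  rcases h s hs with h | ⟨c, hc, h⟩
  · exact Or.inl h
  · exact Or.inr ⟨c, hc.trans hsub, h⟩

lemma IsJPairFst.hasSig {a b : SigPoly k n d} {cp : JPair k n d} (h : IsJPairFst m O a b cp)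
    {s : Sgn n d} (hs : HasSig O a s) : HasSig O cp.toSigPoly (s.shift (multiplier m a.2 b.2)) := by
  obtain ⟨-, -, rfl, -⟩ := h
  exact hs.monomial_smul _ one_ne_zero

lemma multiplier_add (m : MonomialOrder (Fin n)) (p q : MvPolynomial (Fin n) k) :
    multiplier m p q + m.degree p = m.degree p ⊔ m.degree q :=
  tsub_add_cancel_of_le le_sup_left

lemma multiplier_add_comm (m : MonomialOrder (Fin n)) (p q : MvPolynomial (Fin n) k) :
    multiplier m p q + m.degree p = multiplier m q p + m.degree q := by
  rw [multiplier_add, multiplier_add, sup_comm]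

/-- A common multiple of two monomials is a multiple of their lcm, so every cancellation of leading
monomials is a multiple of the one in the J-pair. -/
lemma exists_multiplier {p q : MvPolynomial (Fin n) k} {t t' : Mon n}
    (h : t + m.degree p = t' + m.degree q) :
    ∃ w, t = w + multiplier m p q ∧ t' = w + multiplier m q p := by
  have hle : m.degree p ⊔ m.degree q ≤ t + m.degree p :=
    sup_le le_add_self (h ▸ le_add_self)
  refine ⟨t + m.degree p - (m.degree p ⊔ m.degree q), ?_, ?_⟩
  · rw [← add_left_inj (m.degree p), add_assoc, multiplier_add, tsub_add_cancel_of_le hle]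
  · rw [← add_left_inj (m.degree q), add_assoc, multiplier_add, sup_comm (m.degree q),
      tsub_add_cancel_of_le hle, h]

/-- If the J-pairs whose signature divides `S` are superfluous, then the canonical rewriter of `S`
is not tm-reducible. -/
lemma rewritten_of_superfluous {SG : List (SigPoly k n d)} (hnd : SG.Nodup)
    (hv : ∀ b ∈ SG, Valid f b) (hunit : ∀ i, unitSig f i ∈ SG) {S : Sgn n d}
    (h : ∀ a ∈ SG, ∀ b ∈ SG, ∀ cp, IsJPairFst m O a b cp →
      ∀ s, HasSig O cp.toSigPoly s → s.Divides S → Superfluous O f SG cp) :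
    Rewritten m O f {b | b ∈ SG} S := by
  by_cases hz : SyzSig O f S
  · exact Or.inl hz
  -- The canonical rewriter exists because the unit vector at the position of `S` is in the list and
  -- divides `S`.
  obtain ⟨c, hc, ⟨s, hs, hd⟩, hlast⟩ := exists_last hnd
    (P := fun c => ∃ s, HasSig O c s ∧ s.Divides S)
    ⟨_, hunit S.1, _, hasSig_unitSig O f S.1, rfl, zero_le⟩
  obtain ⟨t, rfl⟩ := Sgn.divides_iff.1 hd
  have hc0 : c.2 ≠ 0 := fun h0 => hz ⟨c, hv c hc, h0, s, hs, hd⟩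
  refine Or.inr ⟨c, hc, hc0, hv c hc, t, s, hs, rfl, ?_⟩
  intro b hb hb0 t' s' hs' hdeg hlt
  -- A tm-reduction of `t c` by `b` is a multiple of a J-pair with first component `c`. Its
  -- superfluity contradicts `hz` or the choice of `c` as last.
  obtain ⟨w, rfl, rfl⟩ := exists_multiplier hdeg
  rw [← Sgn.shift_shift, ← Sgn.shift_shift, ModuleOrder.lt_shift_iff] at hlt
  have hJ : IsJPairFst m O c b (multiplier m c.2 b.2, c) :=
    ⟨hc0, hb0, rfl, s, s', hs, hs', hlt⟩
  have hd' : (s.shift (multiplier m c.2 b.2)).Divides (s.shift (w + multiplier m c.2 b.2)) := by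
    rw [← Sgn.shift_shift]
    exact Sgn.divides_shift _ _
  rcases h c hc b hb _ hJ _ (hJ.hasSig hs) hd' _ (hJ.hasSig hs) with h1 | ⟨c', hc', s'', hs'', h1⟩
  · exact hz (h1.of_divides hd')
  · exact hlast c' hc' ⟨s'', hs'', h1.trans hd'⟩

end Cover

/-! ### Order of occurrence in lists -/

section Lists

variable {α : Type*}

lemma exists_last_split {L : List α} {P : α → Prop} (h : ∃ x ∈ L, P x) :
    ∃ l₁ c l₂, L = l₁ ++ c :: l₂ ∧ P c ∧ ∀ x ∈ l₂, ¬ P x := by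
  induction L with
  | nil => simp at h
  | cons x L ih =>
    by_cases h' : ∃ y ∈ L, P y
    · obtain ⟨l₁, c, l₂, rfl, hc, h2⟩ := ih h'
      exact ⟨x :: l₁, c, l₂, rfl, hc, h2⟩
    · push Not at h'
      obtain ⟨y, hy, hPy⟩ := h
      rcases List.mem_cons.1 hy with rfl | hy
      · exact ⟨[], y, L, rfl, hPy, h'⟩
      · exact absurd hPy (h' y hy)

lemma pair_sublist_append {x y : α} {l₁ l₂ : List α} (hx : x ∈ l₁) (hy : y ∈ l₂) :
    [x, y].Sublist (l₁ ++ l₂) :=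
  (List.singleton_sublist.2 hx).append (List.singleton_sublist.2 hy)

lemma pair_sublist_total {L : List α} {x y : α} (hx : x ∈ L) (hy : y ∈ L) (h : x ≠ y) :
    [x, y].Sublist L ∨ [y, x].Sublist L := by
  obtain ⟨l₁, l₂, rfl⟩ := List.append_of_mem hx
  rcases List.mem_append.1 hy with hy | hy
  · exact Or.inr (pair_sublist_append hy List.mem_cons_self)
  · left
    have hy' : y ∈ l₂ := (List.mem_cons.1 hy).resolve_left (Ne.symm h)
    have := pair_sublist_append (l₁ := [x]) (List.mem_singleton_self x) hy'
    exact this.trans (List.sublist_append_right _ _)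

end Lists

section Invariant

variable {k : Type*} [Field k] {n d : ℕ} {O : ModuleOrder n d} {m : MonomialOrder (Fin n)}
  {f : Fin d → MvPolynomial (Fin n) k}

/-! ### Insertion of new elements -/

lemma InsertByIndex.sublist {sp : SigPoly k n d} {SG SG' : List (SigPoly k n d)}
    (h : InsertByIndex O sp SG SG') : SG.Sublist SG' := by
  obtain ⟨i, l₁, l₂, b, -, rfl, -, -, rfl⟩ := h
  simp

lemma InsertByIndex.perm {sp : SigPoly k n d} {SG SG' : List (SigPoly k n d)}
    (h : InsertByIndex O sp SG SG') : SG'.Perm (sp :: SG) := by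
  obtain ⟨i, l₁, l₂, b, -, rfl, -, -, rfl⟩ := h
  have := List.perm_middle (l₁ := l₁ ++ [b]) (l₂ := l₂) (a := sp)
  simpa using this

lemma InsertByIndex.mem_iff {sp : SigPoly k n d} {SG SG' : List (SigPoly k n d)}
    (h : InsertByIndex O sp SG SG') {b : SigPoly k n d} : b ∈ SG' ↔ b = sp ∨ b ∈ SG := by
  rw [h.perm.mem_iff, List.mem_cons]

/-- A divisor of the signature has the same index, and `sp` goes behind all elements of that index.
-/
lemma InsertByIndex.pair_sublist {sp : SigPoly k n d} {SG SG' : List (SigPoly k n d)}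
    (h : InsertByIndex O sp SG SG') {c : SigPoly k n d} (hc : c ∈ SG) {s s' : Sgn n d}
    (hs : HasSig O sp s) (hs' : HasSig O c s') (hd : s'.Divides s) : [c, sp].Sublist SG' := by
  obtain ⟨i, l₁, l₂, b, ⟨a, ha⟩, rfl, -, hl₂, rfl⟩ := h
  have hi : s'.1 = i := by rw [hd.1, hs.unique ha]
  have hc' : c ∉ l₂ := fun h => hl₂ c h ⟨s'.2, hi ▸ hs'⟩
  have : c ∈ l₁ ++ [b] := by
    simp only [List.mem_append, List.mem_cons] at hc
    simp only [List.mem_append, List.mem_singleton]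
    tauto
  have h2 := pair_sublist_append this (List.mem_cons_self (a := sp) (l := l₂))
  simpa using h2

lemma exists_insertByIndex {sp : SigPoly k n d} {SG : List (SigPoly k n d)} {s : Sgn n d}
    (hs : HasSig O sp s) (hunit : ∀ i, unitSig f i ∈ SG) : ∃ SG', InsertByIndex O sp SG SG' := by
  obtain ⟨l₁, c, l₂, hL, hc, hl₂⟩ := exists_last_split (P := fun c => HasIdx O c s.1)
    ⟨_, hunit s.1, 0, hasSig_unitSig O f s.1⟩
  exact ⟨_, s.1, l₁, l₂, c, ⟨s.2, hs⟩, hL, hc, hl₂, rfl⟩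

/-- Keep one element for each divisibility-minimal signature. Every signature has a minimal divisor
because divisibility implies the well-order `O.le`. -/
lemma exists_superReduced {N : Set (SigPoly k n d)} (hN : ∀ z ∈ N, z.2 = 0) :
    ∃ P, SuperReduced O N P := by
  have h1 : ∀ z ∈ N, z ≠ 0 → ∃ s, HasSig O z s := fun z hz h0 =>
    exists_hasSig O fun h => h0 (Prod.ext h (hN z hz))
  let A : Set (Sgn n d) := {s | ∃ z ∈ N, z ≠ 0 ∧ HasSig O z s}
  have hA : ∀ s : A, ∃ z ∈ N, z ≠ 0 ∧ HasSig O z s := fun s => s.2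
  choose r hrN hr0 hrs using hA
  refine ⟨{y | ∃ s : A, (∀ s' ∈ A, s'.Divides s.1 → s' = s.1) ∧ y = r s}, ?_, ?_, ?_, ?_⟩
  · rintro y ⟨s, -, rfl⟩
    exact hrN s
  · rintro y ⟨s, -, rfl⟩
    exact hr0 s
  · intro z hz h0
    obtain ⟨s, hs⟩ := h1 z hz h0
    obtain ⟨s', ⟨hs'A, hs's⟩, hmin⟩ := O.exists_minimal {s' | s' ∈ A ∧ s'.Divides s}
      ⟨s, ⟨z, hz, h0, hs⟩, Sgn.Divides.refl s⟩
    refine ⟨_, ⟨⟨s', hs'A⟩, fun s'' hs'' hd => ?_, rfl⟩, s', s, hrs _, hs, hs's⟩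
    exact O.le_antisymm _ _ (ModuleOrder.le_of_divides hd) (hmin s'' ⟨hs'', hd.trans hs's⟩)
  · rintro y ⟨s, hs, rfl⟩ z ⟨s', hs', rfl⟩ hne t t' ht ht' hd
    obtain rfl := ht.unique (hrs s)
    obtain rfl := ht'.unique (hrs s')
    exact hne (congrArg r (Subtype.ext (hs' _ s.2 hd)))

/-! ### J-pairs -/

lemma IsJPairFst.ne {a b : SigPoly k n d} {cp : JPair k n d} (h : IsJPairFst m O a b cp) :
    a ≠ b := by
  rintro rfl
  obtain ⟨-, -, -, s, s', hs, hs', hlt⟩ := h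
  rw [hs.unique hs'] at hlt
  exact ModuleOrder.lt_irrefl _ hlt

lemma IsJPairFst.snd_eq {a b : SigPoly k n d} {cp : JPair k n d} (h : IsJPairFst m O a b cp) :
    cp.2 = a := by rw [h.2.2.1]

lemma IsJPairFst.exists_hasSig {a b : SigPoly k n d} {cp : JPair k n d}
    (h : IsJPairFst m O a b cp) : ∃ s, HasSig O cp.toSigPoly s := by
  obtain ⟨s, s', hs, -⟩ := h.2.2.2
  exact ⟨_, h.hasSig hs⟩

lemma JPair.hasSig_toSigPoly {cp : JPair k n d} {s : Sgn n d} (h : HasSig O cp.toSigPoly s) :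
    ∃ s', HasSig O cp.2 s' ∧ s'.shift cp.1 = s := by
  obtain ⟨s', h1, h2⟩ := HasSig.of_monomial_smul one_ne_zero h
  exact ⟨s', h1, h2.symm⟩

/-- The multiplier is the quotient of `s` by the signature of the first component. -/
lemma JPair.ext_of_hasSig {cp cp' : JPair k n d} {s : Sgn n d} (h : HasSig O cp.toSigPoly s)
    (h' : HasSig O cp'.toSigPoly s) (he : cp.2 = cp'.2) : cp = cp' := by
  obtain ⟨t, ht, h1⟩ := JPair.hasSig_toSigPoly h
  obtain ⟨t', ht', h2⟩ := JPair.hasSig_toSigPoly h'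
  rw [he] at ht
  obtain rfl := ht.unique ht'
  exact Prod.ext (Sgn.shift_cancel (h1.trans h2.symm)) he

/-- The first component also has a signature dividing that of `cp`, so it cannot come after the last
such element `b`; being different from `b`, it comes before. -/
lemma superfluous_of_f5Rewritable {SG : List (SigPoly k n d)} {cp : JPair k n d}
    (hmem : cp.2 ∈ SG) (h : F5Rewritable O SG cp) : Superfluous O f SG cp := by
  obtain ⟨s, s', l₁, l₂, b, hs, rfl, hb, hd, hlast, hne⟩ := h
  intro s₂ hs₂
  obtain rfl := hs₂.unique hs
  refine Or.inr ⟨b, ?_, s', hb, hd⟩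
  obtain ⟨t, ht, rfl⟩ := JPair.hasSig_toSigPoly hs
  have h2 : cp.2 ∉ l₂ := fun h => hlast _ h _ ht (Sgn.divides_shift _ _)
  refine pair_sublist_append ?_ List.mem_cons_self
  simp only [List.mem_append, List.mem_cons] at hmem
  rcases hmem with h | h | h
  · exact h
  · exact absurd h.symm hne
  · exact absurd h h2

lemma superfluous_of_tsRewritable {SG : List (SigPoly k n d)} {P : Set (SigPoly k n d)}
    (hP : ∀ z ∈ P, Valid f z ∧ z.2 = 0) {cp : JPair k n d}
    (h : TsRewritable m O P cp.toSigPoly) : Superfluous O f SG cp := by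
  obtain ⟨-, z, hz, t, s, s', hs, hs', rfl, -⟩ := h
  intro s₂ hs₂
  obtain rfl := hs₂.unique hs
  exact Or.inl ⟨z, (hP z hz).1, (hP z hz).2, s', hs', Sgn.divides_shift _ _⟩

/-! ### The loop invariant -/

/-- The part of the invariant that holds at the head of the loop and during tm-reductions. -/
structure BaseInv (m : MonomialOrder (Fin n)) (O : ModuleOrder n d)
    (f : Fin d → MvPolynomial (Fin n) k) (CPs : Set (JPair k n d)) (SG : List (SigPoly k n d))
    (PSyz : Set (SigPoly k n d)) : Prop where
  valid : ∀ b ∈ SG, Valid f b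
  unit_mem : ∀ i, unitSig f i ∈ SG
  nodup : SG.Nodup
  syz : ∀ z ∈ PSyz, Valid f z ∧ z.2 = 0
  finite : CPs.Finite
  isPair : ∀ cp ∈ CPs, ∃ a ∈ SG, ∃ b ∈ SG, IsJPairFst m O a b cp
  inj : ∀ cp ∈ CPs, ∀ cp' ∈ CPs, ∀ s, HasSig O cp.toSigPoly s → HasSig O cp'.toSigPoly s → cp = cp'
  -- The initial elements are exempt: the signature `e_i` may well lie above pending signatures of
  -- other positions.
  lt : ∀ b ∈ SG, (∃ i, b = unitSig f i) ∨
    ∀ s, HasSig O b s → ∀ cp ∈ CPs, ∀ s', HasSig O cp.toSigPoly s' → O.lt s s'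

/-- A J-pair may leave `CPs` only once it is superfluous. For empty `CPs` this is the hypothesis of
`rewritten_of_superfluous` at every signature. -/
structure LoopInv (m : MonomialOrder (Fin n)) (O : ModuleOrder n d)
    (f : Fin d → MvPolynomial (Fin n) k) (CPs : Set (JPair k n d)) (SG : List (SigPoly k n d))
    (PSyz : Set (SigPoly k n d)) : Prop extends BaseInv m O f CPs SG PSyz where
  cover : ∀ a ∈ SG, ∀ b ∈ SG, ∀ cp, IsJPairFst m O a b cp → cp ∈ CPs ∨ Superfluous O f SG cp

/-- The invariant during the tm-reduction of `sp`, which has signature `T`. -/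
structure RedInv (m : MonomialOrder (Fin n)) (O : ModuleOrder n d)
    (f : Fin d → MvPolynomial (Fin n) k) (CPs : Set (JPair k n d)) (SG : List (SigPoly k n d))
    (PSyz : Set (SigPoly k n d)) (sp : SigPoly k n d) (T : Sgn n d) : Prop
    extends BaseInv m O f CPs SG PSyz where
  sp_sig : HasSig O sp T
  sp_valid : Valid f sp
  lt_sig : ∀ b ∈ SG, (∃ i, b = unitSig f i) ∨ ∀ s, HasSig O b s → O.lt s T
  sig_lt : ∀ cp ∈ CPs, ∀ s, HasSig O cp.toSigPoly s → O.lt T s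
  cover : ∀ a ∈ SG, ∀ b ∈ SG, ∀ cp, IsJPairFst m O a b cp →
    cp ∈ CPs ∨ HasSig O cp.toSigPoly T ∨ Superfluous O f SG cp
  -- The strict alternative records that at least one tm-reduction has taken place.
  origin : ∃ a ∈ SG, ∃ b ∈ SG, ∃ cp, IsJPairFst m O a b cp ∧ HasSig O cp.toSigPoly T ∧
    (sp = cp.toSigPoly ∨ leadSyn m sp.2 < leadSyn m cp.toSigPoly.2)

lemma BaseInv.sdiff {CPs : Set (JPair k n d)} {SG : List (SigPoly k n d)}
    {PSyz : Set (SigPoly k n d)} (h : BaseInv m O f CPs SG PSyz) (cp : JPair k n d) :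
    BaseInv m O f (CPs \ {cp}) SG PSyz where
  valid := h.valid
  unit_mem := h.unit_mem
  nodup := h.nodup
  syz := h.syz
  finite := h.finite.sdiff
  isPair := fun cp hcp => h.isPair cp hcp.1
  inj := fun cp hcp cp' hcp' => h.inj cp hcp.1 cp' hcp'.1
  lt := fun b hb => (h.lt b hb).imp_right fun h' s hs cp hcp => h' s hs cp hcp.1

lemma LoopInv.init (m : MonomialOrder (Fin n)) (O : ModuleOrder n d)
    (f : Fin d → MvPolynomial (Fin n) k) :
    LoopInv m O f (initCPs m O f) (initSG f) (initPSyz f) := by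
  have hSG : ∀ b, b ∈ initSG f ↔ ∃ i, b = unitSig f i := fun b => by
    simp [initSG, List.mem_ofFn, eq_comm]
  have hpair : ∀ cp ∈ initCPs m O f, ∃ a ∈ initSG f, ∃ b ∈ initSG f, IsJPairFst m O a b cp := by
    rintro cp ⟨i, j, -, h | h⟩
    · exact ⟨_, (hSG _).2 ⟨i, rfl⟩, _, (hSG _).2 ⟨j, rfl⟩, h⟩
    · exact ⟨_, (hSG _).2 ⟨j, rfl⟩, _, (hSG _).2 ⟨i, rfl⟩, h⟩
  refine ⟨⟨?_, ?_, ?_, ?_, ?_, hpair, ?_, ?_⟩, ?_⟩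
  · intro b hb
    obtain ⟨i, rfl⟩ := (hSG b).1 hb
    exact valid_unitSig f i
  · exact fun i => (hSG _).2 ⟨i, rfl⟩
  · exact List.nodup_ofFn.2 (unitSig_injective f)
  · rintro z ⟨i, j, -, rfl⟩
    exact ⟨(valid_unitSig f j).principalSyzygy (valid_unitSig f i), rfl⟩
  · refine (Set.finite_range fun p : Fin d × Fin d =>
      ((multiplier m (f p.1) (f p.2), unitSig f p.1) : JPair k n d)).subset ?_
    rintro cp ⟨i, j, -, h | h⟩
    · exact ⟨(i, j), h.2.2.1.symm⟩
    · exact ⟨(j, i), h.2.2.1.symm⟩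
  · intro cp hcp cp' hcp' s hs hs'
    obtain ⟨a, ha, b, -, h⟩ := hpair cp hcp
    obtain ⟨a', ha', b', -, h'⟩ := hpair cp' hcp'
    obtain ⟨i, rfl⟩ := (hSG a).1 ha
    obtain ⟨i', rfl⟩ := (hSG a').1 ha'
    have h1 := hs.unique (h.hasSig (hasSig_unitSig O f i))
    have h2 := hs'.unique (h'.hasSig (hasSig_unitSig O f i'))
    -- Among the initial pairs, the position of the signature already determines the first
    -- component.
    have h3 : i = i' := (congrArg Prod.fst (h1.symm.trans h2) :)
    exact JPair.ext_of_hasSig hs hs' (by rw [h.snd_eq, h'.snd_eq, h3])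
  · exact fun b hb => Or.inl ((hSG b).1 hb)
  · intro a ha b hb cp h
    left
    obtain ⟨i, rfl⟩ := (hSG a).1 ha
    obtain ⟨j, rfl⟩ := (hSG b).1 hb
    rcases lt_trichotomy i j with hij | rfl | hij
    · exact ⟨i, j, hij, Or.inl h⟩
    · exact absurd rfl h.ne
    · exact ⟨j, i, hij, Or.inr h⟩

section Steps

variable {CPs : Set (JPair k n d)} {SG SG' : List (SigPoly k n d)} {PSyz PSyz' : Set (SigPoly k n d)}
  {sp sp' : SigPoly k n d} {cp : JPair k n d} {T : Sgn n d}

lemma LoopInv.discard (h : LoopInv m O f CPs SG PSyz) (hcp : cp ∈ CPs)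
    (hr : TsRewritable m O PSyz cp.toSigPoly ∨ F5Rewritable O SG cp) :
    LoopInv m O f (CPs \ {cp}) SG PSyz := by
  refine ⟨h.toBaseInv.sdiff cp, fun a ha b hb cp' hJ => ?_⟩
  rcases h.cover a ha b hb cp' hJ with hmem | hs
  · by_cases he : cp' = cp
    · subst he
      right
      rcases hr with hr | hr
      · exact superfluous_of_tsRewritable h.syz hr
      · exact superfluous_of_f5Rewritable (hJ.snd_eq ▸ ha) hr
    · exact Or.inl ⟨hmem, he⟩
  · exact Or.inr hs

lemma LoopInv.exists_isMinJPair (h : LoopInv m O f CPs SG PSyz) (hne : CPs.Nonempty) :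
    ∃ cp, IsMinJPair O CPs cp := by
  obtain ⟨cp₀, hcp₀⟩ := hne
  obtain ⟨a, -, b, -, hJ⟩ := h.isPair cp₀ hcp₀
  obtain ⟨s₀, hs₀⟩ := hJ.exists_hasSig
  obtain ⟨s, ⟨cp, hcp, hs⟩, hmin⟩ :=
    O.exists_minimal {s | ∃ cp ∈ CPs, HasSig O cp.toSigPoly s} ⟨s₀, cp₀, hcp₀, hs₀⟩
  exact ⟨cp, hcp, s, hs, fun cp' hcp' s' hs' => hmin s' ⟨cp', hcp', hs'⟩⟩

lemma LoopInv.select (h : LoopInv m O f CPs SG PSyz) (hmin : IsMinJPair O CPs cp) :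
    ∃ T, RedInv m O f (CPs \ {cp}) SG PSyz cp.toSigPoly T := by
  obtain ⟨hcp, T, hT, hle⟩ := hmin
  obtain ⟨a, ha, b, hb, hJ⟩ := h.isPair cp hcp
  refine ⟨T, h.toBaseInv.sdiff cp, hT, ?_, ?_, ?_, ?_, a, ha, b, hb, cp, hJ, hT, Or.inl rfl⟩
  · exact (hJ.snd_eq ▸ h.valid a ha).smul _
  · exact fun b hb => (h.lt b hb).imp_right fun h' s hs => h' s hs cp hcp T hT
  -- Pending J-pairs have distinct signatures, so the minimum is strict.
  · rintro cp' ⟨hcp', hne⟩ s hs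
    refine ModuleOrder.lt_of_le_of_ne (hle cp' hcp' s hs) ?_
    rintro rfl
    exact hne (h.inj _ hcp' _ hcp _ hs hT)
  · intro a ha b hb cp' hJ'
    by_cases he : cp' = cp
    · exact Or.inr (Or.inl (he ▸ hT))
    · exact (h.cover a ha b hb cp' hJ').imp (fun h => ⟨h, he⟩) Or.inr

lemma TmReduces.leadSyn_lt {B : Set (SigPoly k n d)} (h : TmReduces m O B sp sp') :
    leadSyn m sp'.2 < leadSyn m sp.2 := by
  obtain ⟨h0, b, -, hb0, t, s, s', -, -, hdeg, -, rfl⟩ := h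
  exact leadSyn_sub_lt h0 hb0 hdeg

lemma RedInv.tmReduce (h : RedInv m O f CPs SG PSyz sp T)
    (hr : TmReduces m O {b | b ∈ SG} sp sp') : RedInv m O f CPs SG PSyz sp' T := by
  have hlead := hr.leadSyn_lt
  obtain ⟨h0, b, hb, hb0, t, s, s', hs, hs', hdeg, hlt, rfl⟩ := hr
  obtain rfl := hs.unique h.sp_sig
  refine ⟨h.toBaseInv, ?_, h.sp_valid.sub ((h.valid b hb).smul _), h.lt_sig, h.sig_lt, h.cover, ?_⟩
  · refine hs.sub_of_lt (hs'.monomial_smul t ?_) hlt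
    exact div_ne_zero (m.leadingCoeff_ne_zero_iff.2 h0) (m.leadingCoeff_ne_zero_iff.2 hb0)
  · obtain ⟨a, ha, b, hb, cp, hJ, hT, h'⟩ := h.origin
    refine ⟨a, ha, b, hb, cp, hJ, hT, Or.inr ?_⟩
    rcases h' with rfl | h'
    · exact hlead
    · exact hlead.trans h'

lemma not_lt_of_irreducible (hsp : sp.2 ≠ 0) (hT : HasSig O sp T)
    (hirr : ∀ sp', ¬ TmReduces m O {b | b ∈ SG} sp sp') {b : SigPoly k n d} (hb : b ∈ SG)
    (hb0 : b.2 ≠ 0) {s : Sgn n d} (hs : HasSig O b s) {t : Mon n}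
    (hdeg : t + m.degree b.2 = m.degree sp.2) : ¬ O.lt (s.shift t) T := fun hlt =>
  hirr _ ⟨hsp, b, hb, hb0, t, T, s, hT, hs, hdeg, hlt, rfl⟩

/-- A J-pair is tm-reducible by its second component, so an irreducible `sp` has been reduced at
least once. -/
lemma RedInv.leadSyn_lt (h : RedInv m O f CPs SG PSyz sp T)
    (hirr : ∀ sp', ¬ TmReduces m O {b | b ∈ SG} sp sp') :
    ∃ a ∈ SG, ∃ b ∈ SG, ∃ cp, IsJPairFst m O a b cp ∧ HasSig O cp.toSigPoly T ∧
      leadSyn m sp.2 < leadSyn m cp.toSigPoly.2 := by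
  obtain ⟨a, ha, b, hb, cp, hJ, hT, h'⟩ := h.origin
  refine ⟨a, ha, b, hb, cp, hJ, hT, h'.resolve_left ?_⟩
  rintro rfl
  obtain ⟨ha0, hb0, rfl, s, s', hs, hs', hlt⟩ := hJ
  have h2 : (JPair.toSigPoly (multiplier m a.2 b.2, a)).2 = monomial (multiplier m a.2 b.2) 1 * a.2 :=
    rfl
  rw [(hs.monomial_smul (multiplier m a.2 b.2) one_ne_zero).unique h.sp_sig] at hlt
  refine not_lt_of_irreducible (h2 ▸ mul_ne_zero (by simp) ha0) h.sp_sig hirr hb hb0 hs' ?_ hlt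
  rw [h2, degree_monomial_mul one_ne_zero ha0, multiplier_add_comm]

/-- Elements of `SG` other than the initial ones have signature below `T`. If `sp` were an initial
element, its J-pair would have multiplier `1` and coincide with `sp`, against the strict drop of the
leading monomial. -/
lemma RedInv.notMem (h : RedInv m O f CPs SG PSyz sp T)
    (hirr : ∀ sp', ¬ TmReduces m O {b | b ∈ SG} sp sp') : sp ∉ SG := by
  intro hmem
  obtain ⟨a, ha, b, hb, cp, hJ, hT, hlt⟩ := h.leadSyn_lt hirr
  rcases h.lt_sig sp hmem with ⟨i, hi⟩ | h'
  · have hTi : T = (i, 0) := h.sp_sig.unique (hi ▸ hasSig_unitSig O f i)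
    obtain ⟨s, hs, hsT⟩ := JPair.hasSig_toSigPoly hT
    rw [hJ.snd_eq] at hs
    have h0 : cp.1 = 0 := by
      have := congrArg Prod.snd (hsT.trans hTi)
      exact (add_eq_zero.1 this).1
    rw [h0, Sgn.shift_zero] at hsT
    rcases h.lt_sig a ha with ⟨j, hj⟩ | h''
    · have hij : j = i := by
        have := (hj ▸ hasSig_unitSig O f j : HasSig O a (j, 0)).unique hs
        rw [hsT, hTi] at this
        exact congrArg Prod.fst this
      have : cp.toSigPoly = sp := by
        rw [JPair.toSigPoly, h0, hJ.snd_eq, hj, hij, ← hi]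
        exact one_smul _ sp
      rw [this] at hlt
      exact lt_irrefl _ hlt
    · exact ModuleOrder.lt_irrefl _ (hsT ▸ h'' s hs)
  · exact ModuleOrder.lt_irrefl _ (h' T h.sp_sig)

/-- The new element stands behind the first component of every old J-pair of signature `T`, and
thereby settles all of them at once. -/
lemma RedInv.superfluous_insert (h : RedInv m O f CPs SG PSyz sp T)
    (hins : InsertByIndex O sp SG SG') {a b : SigPoly k n d} (ha : a ∈ SG)
    (hJ : IsJPairFst m O a b cp) (hT : HasSig O cp.toSigPoly T) : Superfluous O f SG' cp := by
  intro s hs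
  obtain rfl := hs.unique hT
  refine Or.inr ⟨sp, ?_, s, h.sp_sig, Sgn.Divides.refl _⟩
  obtain ⟨s', hs', rfl⟩ := JPair.hasSig_toSigPoly hs
  exact hins.pair_sublist (hJ.snd_eq ▸ ha) h.sp_sig hs' (Sgn.divides_shift _ _)

lemma RedInv.insertSyzygy (h : RedInv m O f CPs SG PSyz sp T) (hsp : sp.2 = 0)
    (hins : InsertByIndex O sp SG SG') : LoopInv m O f CPs SG' PSyz := by
  have hnot : sp ∉ SG := h.notMem fun sp' hr => hr.1 hsp
  refine ⟨⟨?_, ?_, ?_, h.syz, h.finite, ?_, h.inj, ?_⟩, ?_⟩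
  · intro b hb
    rcases hins.mem_iff.1 hb with rfl | hb
    exacts [h.sp_valid, h.valid b hb]
  · exact fun i => hins.mem_iff.2 (Or.inr (h.unit_mem i))
  · exact hins.perm.nodup_iff.2 (List.nodup_cons.2 ⟨hnot, h.nodup⟩)
  · intro cp hcp
    obtain ⟨a, ha, b, hb, hJ⟩ := h.isPair cp hcp
    exact ⟨a, hins.sublist.subset ha, b, hins.sublist.subset hb, hJ⟩
  · intro b hb
    rcases hins.mem_iff.1 hb with rfl | hb
    · exact Or.inr fun s hs cp hcp s' hs' => hs.unique h.sp_sig ▸ h.sig_lt cp hcp s' hs'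
    · exact h.lt b hb
  · intro a ha b hb cp hJ
    have ha' := (hins.mem_iff.1 ha).resolve_left fun he => hJ.1 (he ▸ hsp)
    have hb' := (hins.mem_iff.1 hb).resolve_left fun he => hJ.2.1 (he ▸ hsp)
    rcases h.cover a ha' b hb' cp hJ with h1 | h1 | h1
    · exact Or.inl h1
    · exact Or.inr (h.superfluous_insert hins ha' hJ h1)
    · exact Or.inr (h1.mono hins.sublist)

/-- If `sp` is the first component, a multiplier `1` would make `sp` tm-reducible by `b`. If `b` is,
then the signature strictly exceeds a multiple of `T`. Hence signatures are processed in increasing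
order. -/
lemma RedInv.lt_newPair (h : RedInv m O f CPs SG PSyz sp T)
    (hirr : ∀ sp', ¬ TmReduces m O {b | b ∈ SG} sp sp') {b : SigPoly k n d} (hb : b ∈ SG)
    (hJ : IsJPair m O sp b cp) {s : Sgn n d} (hs : HasSig O cp.toSigPoly s) : O.lt T s := by
  rcases hJ with hJ | hJ
  · have hJ' := hJ
    obtain ⟨h0, hb0, rfl, s₁, s₂, hs₁, hs₂, hlt⟩ := hJ'
    obtain rfl := hs₁.unique h.sp_sig
    rw [hs.unique (hJ.hasSig hs₁)]
    refine ModuleOrder.lt_shift_self (fun hm => ?_) _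
    rw [hm, Sgn.shift_zero] at hlt
    refine not_lt_of_irreducible h0 hs₁ hirr hb hb0 hs₂ ?_ hlt
    rw [← multiplier_add_comm, hm, zero_add]
  · have hJ' := hJ
    obtain ⟨h0, hb0, rfl, s₁, s₂, hs₁, hs₂, hlt⟩ := hJ'
    obtain rfl := hs₂.unique h.sp_sig
    rw [hs.unique (hJ.hasSig hs₁)]
    exact ModuleOrder.lt_of_le_of_lt (ModuleOrder.le_shift _ _) hlt

lemma RedInv.insert (h : RedInv m O f CPs SG PSyz sp T)
    (hirr : ∀ sp', ¬ TmReduces m O {b | b ∈ SG} sp sp') (hins : InsertByIndex O sp SG SG')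
    (hP : PSyz' ⊆ PSyz ∪ {z | ∃ b ∈ SG', b.2 ≠ 0 ∧ z = principalSyzygy b sp}) :
    LoopInv m O f
      (dedup O SG' (CPs ∪ {cp | ∃ b ∈ SG', b.2 ≠ 0 ∧ b ≠ sp ∧ IsJPair m O sp b cp})) SG' PSyz' := by
  have hnot : sp ∉ SG := h.notMem hirr
  set N := CPs ∪ {cp | ∃ b ∈ SG', b.2 ≠ 0 ∧ b ≠ sp ∧ IsJPair m O sp b cp} with hN
  have hsub : dedup O SG' N ⊆ N := fun cp hcp => hcp.1
  have hspm : sp ∈ SG' := hins.mem_iff.2 (Or.inl rfl)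
  have hvalid : ∀ b ∈ SG', Valid f b := by
    intro b hb
    rcases hins.mem_iff.1 hb with rfl | hb
    exacts [h.sp_valid, h.valid b hb]
  have hpair : ∀ cp ∈ N, ∃ a ∈ SG', ∃ b ∈ SG', IsJPairFst m O a b cp := by
    rintro cp (hcp | ⟨b, hb, -, -, hJ | hJ⟩)
    · obtain ⟨a, ha, b, hb, hJ⟩ := h.isPair cp hcp
      exact ⟨a, hins.sublist.subset ha, b, hins.sublist.subset hb, hJ⟩
    · exact ⟨sp, hspm, b, hb, hJ⟩
    · exact ⟨b, hb, sp, hspm, hJ⟩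
  have hTlt : ∀ cp ∈ N, ∀ s, HasSig O cp.toSigPoly s → O.lt T s := by
    rintro cp (hcp | ⟨b, hb, -, hne, hJ⟩) s hs
    · exact h.sig_lt cp hcp s hs
    · exact h.lt_newPair hirr ((hins.mem_iff.1 hb).resolve_left hne) hJ hs
  -- A pair dropped by `dedup` is superfluous: the first component of its rival comes later and has
  -- a signature dividing the common one.
  have hcov : ∀ cp ∈ N, cp ∈ dedup O SG' N ∨ Superfluous O f SG' cp := by
    intro cp hcp
    by_cases hd : cp ∈ dedup O SG' N
    · exact Or.inl hd
    · right
      simp only [dedup, Set.mem_ofPred_eq, not_and, not_forall, not_not] at hd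
      obtain ⟨cp', -, s, hs, hs', hsubl⟩ := hd hcp
      intro s₂ hs₂
      obtain rfl := hs₂.unique hs
      obtain ⟨s', h1, rfl⟩ := JPair.hasSig_toSigPoly hs'
      exact Or.inr ⟨cp'.2, hsubl, s', h1, Sgn.divides_shift _ _⟩
  refine ⟨⟨hvalid, ?_, ?_, ?_, ?_, fun cp hcp => hpair cp (hsub hcp), ?_, ?_⟩, ?_⟩
  · exact fun i => hins.mem_iff.2 (Or.inr (h.unit_mem i))
  · exact hins.perm.nodup_iff.2 (List.nodup_cons.2 ⟨hnot, h.nodup⟩)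
  · intro z hz
    rcases hP hz with hz | ⟨b, hb, -, rfl⟩
    · exact h.syz z hz
    · exact ⟨(hvalid b hb).principalSyzygy h.sp_valid, rfl⟩
  · refine Set.Finite.subset (h.finite.union ?_) hsub
    have hfin : {b | b ∈ SG'}.Finite := List.finite_toSet SG'
    refine ((hfin.image fun b => ((multiplier m sp.2 b.2, sp) : JPair k n d)).union
      (hfin.image fun b => ((multiplier m b.2 sp.2, b) : JPair k n d))).subset ?_
    rintro cp ⟨b, hb, -, -, hJ | hJ⟩
    · exact Or.inl ⟨b, hb, hJ.2.2.1.symm⟩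
    · exact Or.inr ⟨b, hb, hJ.2.2.1.symm⟩
  · intro cp hcp cp' hcp' s hs hs'
    by_cases he : cp.2 = cp'.2
    · exact JPair.ext_of_hasSig hs hs' he
    obtain ⟨a, ha, b, -, hJ⟩ := hpair cp hcp.1
    obtain ⟨a', ha', b', -, hJ'⟩ := hpair cp' hcp'.1
    -- Of two pairs with equal signature, `dedup` would have dropped the one whose first component
    -- comes earlier.
    rcases pair_sublist_total (hJ.snd_eq ▸ ha) (hJ'.snd_eq ▸ ha') he with h1 | h1
    · exact absurd h1 (hcp.2 cp' hcp'.1 s hs hs')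
    · exact absurd h1 (hcp'.2 cp hcp.1 s hs' hs)
  · intro b hb
    rcases hins.mem_iff.1 hb with rfl | hb
    · exact Or.inr fun s hs cp hcp s' hs' => hs.unique h.sp_sig ▸ hTlt cp hcp.1 s' hs'
    · exact (h.lt_sig b hb).imp_right fun h' s hs cp hcp s' hs' =>
        ModuleOrder.lt_trans (h' s hs) (hTlt cp hcp.1 s' hs')
  · intro a ha b hb cp hJ
    by_cases hasp : a = sp
    · subst hasp
      exact hcov cp (Or.inr ⟨b, hb, hJ.2.1, hJ.ne.symm, Or.inl hJ⟩)
    by_cases hbsp : b = sp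
    · subst hbsp
      exact hcov cp (Or.inr ⟨a, ha, hJ.1, hJ.ne, Or.inr hJ⟩)
    have ha' := (hins.mem_iff.1 ha).resolve_left hasp
    rcases h.cover a ha' b ((hins.mem_iff.1 hb).resolve_left hbsp) cp hJ with h1 | h1 | h1
    · exact hcov cp (Or.inl h1)
    · exact Or.inr (h.superfluous_insert hins ha' hJ h1)
    · exact Or.inr (h1.mono hins.sublist)

/-! ### Consequences of the invariant -/

lemma LoopInv.isGroebnerBasis (h : LoopInv m O f ∅ SG PSyz) :
    IsGroebnerBasis m {g | ∃ b ∈ SG, b.2 ≠ 0 ∧ g = b.2} (Ideal.span (Set.range f)) := by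
  refine ⟨?_, ?_, ?_⟩
  · refine ((List.finite_toSet SG).image Prod.snd).subset ?_
    rintro g ⟨b, hb, -, rfl⟩
    exact ⟨b, hb, rfl⟩
  · rintro g ⟨b, hb, hb0, rfl⟩
    exact ⟨hb0, (h.valid b hb).snd_mem⟩
  · intro p hp h0
    obtain ⟨u, hu⟩ := exists_valid hp
    obtain ⟨S, hS⟩ := exists_hasSig O (sp := (u, p)) fun hu0 => h0 (hu.snd_eq_zero hu0)
    obtain ⟨b, hb, hb0, t, -, -, hdeg, -⟩ := covers_of_rewritten S
      (fun S' _ => rewritten_of_superfluous h.nodup h.valid h.unit_mem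
        fun a ha b hb cp hJ _ _ _ => (h.cover a ha b hb cp hJ).resolve_left (Set.notMem_empty cp))
      (u, p) hu hS h0
    exact ⟨b.2, ⟨b, hb, hb0, rfl⟩, hdeg ▸ le_add_self⟩

/-- All pending signatures exceed `T`, so every J-pair relevant to a signature below `T` is already
superfluous. -/
lemma RedInv.covers (h : RedInv m O f CPs SG PSyz sp T) {S : Sgn n d} (hS : O.lt S T) :
    Covers m O f {b | b ∈ SG} S := by
  refine covers_of_rewritten S fun S' hS' => rewritten_of_superfluous h.nodup h.valid h.unit_mem ?_
  intro a ha b hb cp hJ s hs hd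
  have hlt : O.lt s T := ModuleOrder.lt_of_le_of_lt
    (O.le_trans _ _ _ (ModuleOrder.le_of_divides hd) hS') hS
  rcases h.cover a ha b hb cp hJ with h1 | h1 | h1
  · exact absurd (ModuleOrder.lt_trans hlt (h.sig_lt cp h1 s hs)) (ModuleOrder.lt_irrefl _)
  · rw [hs.unique h1] at hlt
    exact absurd hlt (ModuleOrder.lt_irrefl _)
  · exact h1

/-- What is known about an element `sp` of signature `T`, with nonzero polynomial part, that is
about to be inserted into `SG`. -/
structure Fresh (m : MonomialOrder (Fin n)) (O : ModuleOrder n d) (SG : List (SigPoly k n d))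
    (sp : SigPoly k n d) (T : Sgn n d) : Prop where
  ne_zero : sp.2 ≠ 0
  hasSig : HasSig O sp T
  notMem : sp ∉ SG
  -- If `c` divides `sp` both in signature and in leading monomial, the two have the same ratio.
  ratio_eq : ∀ c ∈ SG, c.2 ≠ 0 → ∀ s t t', HasSig O c s → s.shift t = T →
    t' + m.degree c.2 = m.degree sp.2 → t = t'
  -- The last two inequalities, with denominators cleared, say that the ratios of `a` and `b` are
  -- smaller than that of `sp`.
  origin : ∃ a ∈ SG, ∃ b ∈ SG, a.2 ≠ 0 ∧ b.2 ≠ 0 ∧ ∃ s s', HasSig O a s ∧ HasSig O b s' ∧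
    T = s.shift (multiplier m a.2 b.2) ∧
    O.lt (s.shift (m.degree sp.2)) (T.shift (m.degree a.2)) ∧
    O.lt (s'.shift (m.degree sp.2)) (T.shift (m.degree b.2))

/-- If `t` is smaller than `t'`, subtracting a scalar multiple of `t c` from `sp` keeps the leading
monomial and lowers the signature, so `RedInv.covers` yields a tm-reduction of `sp`. If `t` is
larger, `c` itself tm-reduces `sp`. -/
lemma RedInv.ratio_eq (hO : O.Compatible m) (h : RedInv m O f CPs SG PSyz sp T)
    (hirr : ∀ sp', ¬ TmReduces m O {b | b ∈ SG} sp sp') (hsp : sp.2 ≠ 0) {c : SigPoly k n d}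
    (hc : c ∈ SG) (hc0 : c.2 ≠ 0) {s : Sgn n d} {t t' : Mon n} (hs : HasSig O c s)
    (hT : s.shift t = T) (hdeg : t' + m.degree c.2 = m.degree sp.2) : t = t' := by
  rcases lt_trichotomy (m.toSyn t) (m.toSyn t') with hlt | heq | hlt
  · exfalso
    have hTc := hs.monomial_smul t (one_ne_zero (α := k))
    rw [hT] at hTc
    obtain ⟨e, he, h'⟩ := h.sp_sig.exists_sub_lt hTc
    set sp' := sp - monomial (0 : Mon n) e • monomial t (1 : k) • c with hsp'
    have hv' : Valid f sp' := h.sp_valid.sub (((h.valid c hc).smul _).smul _)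
    have hdeg' : m.degree (monomial (0 : Mon n) e * (monomial t (1 : k) * c.2)) =
        t + m.degree c.2 := by
      rw [degree_monomial_mul he (mul_ne_zero (by simp) hc0),
        degree_monomial_mul one_ne_zero hc0, zero_add]
    have hlt' : m.toSyn (m.degree (monomial (0 : Mon n) e * (monomial t (1 : k) * c.2))) <
        m.toSyn (m.degree sp.2) := by
      rw [hdeg', ← hdeg, map_add, map_add]
      gcongr
    have h2 : sp'.2 = sp.2 - monomial (0 : Mon n) e * (monomial t (1 : k) * c.2) := rfl
    have hd2 : m.degree sp'.2 = m.degree sp.2 := by rw [h2, m.degree_sub_of_lt hlt']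
    have h20 : sp'.2 ≠ 0 := by
      intro h0
      rw [h2, sub_eq_zero] at h0
      rw [← h0] at hlt'
      exact lt_irrefl _ hlt'
    rcases h' with h' | ⟨S, hS, hST⟩
    · exact h20 (hv'.snd_eq_zero h')
    obtain ⟨b, hb, hb0, w, s', hs', hdb, hle⟩ := h.covers hST sp' hv' hS h20
    exact not_lt_of_irreducible hsp h.sp_sig hirr hb hb0 hs' (hdb.trans hd2)
      (ModuleOrder.lt_of_le_of_lt hle hST)
  · exact m.toSyn.injective heq
  · exact absurd (hT ▸ hO.shift_lt hlt s) (not_lt_of_irreducible hsp h.sp_sig hirr hc hc0 hs hdeg)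

lemma RedInv.fresh (hO : O.Compatible m) (h : RedInv m O f CPs SG PSyz sp T)
    (hirr : ∀ sp', ¬ TmReduces m O {b | b ∈ SG} sp sp') (hsp : sp.2 ≠ 0) :
    Fresh m O SG sp T := by
  refine ⟨hsp, h.sp_sig, h.notMem hirr,
    fun c hc hc0 s t t' hs hT hdeg => h.ratio_eq hO hirr hsp hc hc0 hs hT hdeg, ?_⟩
  obtain ⟨a, ha, b, hb, cp, hJ, hT, hlead⟩ := h.leadSyn_lt hirr
  obtain ⟨ha0, hb0, rfl, s, s', hs, hs', hlt⟩ := hJ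
  have h2 : (JPair.toSigPoly (multiplier m a.2 b.2, a)).2 = monomial (multiplier m a.2 b.2) 1 * a.2 :=
    rfl
  obtain rfl := hT.unique (hs.monomial_smul _ one_ne_zero)
  rw [h2, leadSyn_of_ne_zero hsp, leadSyn_of_ne_zero (mul_ne_zero (by simp) ha0),
    degree_monomial_mul one_ne_zero ha0, WithBot.coe_lt_coe] at hlead
  refine ⟨a, ha, b, hb, ha0, hb0, s, s', hs, hs', rfl, ?_, ?_⟩
  · rw [Sgn.shift_shift, add_comm (m.degree a.2)]
    exact hO.shift_lt hlead s
  -- Multiply by the multiplier of `b` and compare through `T` times the leading monomial of `sp`;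
  -- both multiplied leading monomials are the same lcm.
  · rw [← ModuleOrder.lt_shift_iff (multiplier m b.2 a.2)]
    refine ModuleOrder.lt_trans (s' := (s.shift (multiplier m a.2 b.2)).shift (m.degree sp.2)) ?_ ?_
    · rw [Sgn.shift_comm, ModuleOrder.lt_shift_iff]
      exact hlt
    · rw [Sgn.shift_shift (multiplier m b.2 a.2), ← multiplier_add_comm]
      exact hO.shift_lt hlead _

end Steps

end Invariant

/-! ### Ratios of signatures and leading monomials -/

section Ratio

variable {n d : ℕ} {O : ModuleOrder n d}

/-- The order on the formal quotients `x.1 / x.2` of a signature and a monomial. -/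
def RatioLt (O : ModuleOrder n d) (x y : Sgn n d × Mon n) : Prop :=
  O.lt (x.1.shift y.2) (y.1.shift x.2)

/-- Multiplication of a signature and a monomial by the same monomial. -/
noncomputable def scale (t : Mon n) (x : Sgn n d × Mon n) : Sgn n d × Mon n :=
  (x.1.shift t, t + x.2)

lemma ratioLt_scale_right {t : Mon n} {x y : Sgn n d × Mon n} :
    RatioLt O x (scale t y) ↔ RatioLt O x y := by
  rw [RatioLt, scale, RatioLt, add_comm, ← Sgn.shift_shift, Sgn.shift_comm x.2,
    Sgn.shift_comm y.2, ModuleOrder.lt_shift_iff]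

lemma ratioLt_scale_left {t : Mon n} {x y : Sgn n d × Mon n} :
    RatioLt O (scale t x) y ↔ RatioLt O x y := by
  rw [RatioLt, scale, RatioLt, Sgn.shift_comm y.2, ← Sgn.shift_shift, ModuleOrder.lt_shift_iff]

lemma RatioLt.trans {x y z : Sgn n d × Mon n} (h : RatioLt O x y) (h' : RatioLt O y z) :
    RatioLt O x z := by
  unfold RatioLt at *
  rw [← ModuleOrder.lt_shift_iff y.2]
  rw [← ModuleOrder.lt_shift_iff z.2, Sgn.shift_comm z.2, Sgn.shift_comm z.2 x.2] at h
  rw [← ModuleOrder.lt_shift_iff x.2, Sgn.shift_comm x.2 y.2] at h'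
  exact ModuleOrder.lt_trans h h'

/-- By Dickson's lemma finitely many indices `K` are minimal for divisibility in both components,
and by `h1` every other index has the ratio of one of them. Induct on that ratio: by `h2` each
signature of a given ratio comes from a pair of data of smaller ratio, of which there are finitely
many, and by `h3` signatures determine indices. -/
lemma finite_of_ratio (O : ModuleOrder n d) (I : Set ℕ) (x : ℕ → Sgn n d × Mon n)
    (D : Set (Sgn n d × Mon n)) (hD : D.Finite)
    (h1 : ∀ i ∈ I, ∀ j ∈ I, i < j → ∀ t t', (x i).1.shift t = (x j).1 →
      t' + (x i).2 = (x j).2 → t = t')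
    (h2 : ∀ j ∈ I, ∃ p ∈ D ∪ x '' I, ∃ q ∈ D ∪ x '' I,
      (x j).1 = p.1.shift (p.2 ⊔ q.2 - p.2) ∧ RatioLt O p (x j) ∧ RatioLt O q (x j))
    (h3 : ∀ i ∈ I, ∀ j ∈ I, i < j → (x i).1 ≠ (x j).1) : I.Finite := by
  classical
  let Div : Sgn n d × Mon n → Sgn n d × Mon n → Prop := fun y z => y.1.Divides z.1 ∧ y.2 ≤ z.2
  have hwqo : WellQuasiOrdered Div :=
    (Sgn.wellQuasiOrdered_divides (n := n) (d := d)).prod (wellQuasiOrdered_le (α := Mon n))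
  let K : Set ℕ := {i | i ∈ I ∧ ∀ i' ∈ I, i' < i → ¬ Div (x i') (x i)}
  have hK : K.Finite := by
    by_contra hinf
    have : Infinite K := Set.infinite_coe_iff.2 hinf
    obtain ⟨i, j, hij, hdiv⟩ := hwqo fun i => x (Nat.orderEmbeddingOfSet K i)
    have hmem : ∀ i, Nat.orderEmbeddingOfSet K i ∈ K := fun i =>
      (Nat.orderEmbeddingOfSet_range K).subset (Set.mem_range_self i)
    exact (hmem j).2 _ (hmem i).1 ((Nat.orderEmbeddingOfSet K).strictMono hij) hdiv
  let C : ℕ → Set ℕ := fun k => {i | i ∈ I ∧ ∃ t, x i = scale t (x k)}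
  have hC : ∀ i ∈ I, ∃ k ∈ K, i ∈ C k := by
    intro i hi
    have hex : ∃ k, k ∈ I ∧ k ≤ i ∧ Div (x k) (x i) :=
      ⟨i, hi, le_rfl, Sgn.Divides.refl _, le_rfl⟩
    -- The least index whose datum divides `x i` lies in `K`, because divisibility is transitive.
    obtain ⟨hkI, hki, hdiv⟩ := Nat.find_spec hex
    refine ⟨Nat.find hex, ⟨hkI, fun i' hi' hlt hd => ?_⟩, hi, ?_⟩
    · exact Nat.find_min hex hlt ⟨hi', hlt.le.trans hki,
        hd.1.trans hdiv.1, hd.2.trans hdiv.2⟩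
    · obtain ⟨t, ht⟩ := Sgn.divides_iff.1 hdiv.1
      refine ⟨t, ?_⟩
      rcases hki.eq_or_lt with heq | hlt
      · rw [heq] at ht ⊢
        have : t = 0 := Sgn.shift_cancel (ht.trans (Sgn.shift_zero _).symm)
        simp [scale, this]
      · have hadd := tsub_add_cancel_of_le hdiv.2
        rw [← h1 _ hkI i hi hlt t _ ht hadd] at hadd
        exact Prod.ext ht.symm hadd.symm
  let r : ℕ → ℕ → Prop := fun i j => RatioLt O (x i) (x j)
  have : IsStrictOrder ℕ r :=
    { irrefl := fun i => ModuleOrder.lt_irrefl _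
      trans := fun _ _ _ => RatioLt.trans }
  have hfin : ∀ k ∈ K, (C k).Finite := by
    intro k hk
    -- A strict order is well-founded on the finite set `K`, although it need not be on all ratios.
    refine (hK.wellFoundedOn (r := r)).induction hk (P := fun k => (C k).Finite) ?_
    intro k hk ih
    let A := D ∪ ⋃ k' ∈ {k' | k' ∈ K ∧ r k' k}, x '' C k'
    have hA : A.Finite :=
      hD.union ((hK.subset fun k' h => h.1).biUnion fun k' hk' => (ih k' hk'.1 hk'.2).image x)
    have hmem : ∀ i ∈ C k, ∀ p ∈ D ∪ x '' I, RatioLt O p (x i) → p ∈ A := by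
      rintro i ⟨-, t, ht⟩ p (hp | ⟨j, hj, rfl⟩) hlt
      · exact Or.inl hp
      · obtain ⟨k', hk', hjk'⟩ := hC j hj
        refine Or.inr (Set.mem_biUnion (x := k') ⟨hk', ?_⟩ ⟨j, hjk', rfl⟩)
        obtain ⟨-, t', ht'⟩ := hjk'
        rwa [ht, ht', ratioLt_scale_right, ratioLt_scale_left] at hlt
    refine Set.Finite.of_finite_image (f := fun i => (x i).1) ?_ ?_
    · refine (hA.image2 (fun p q : Sgn n d × Mon n => p.1.shift (p.2 ⊔ q.2 - p.2)) hA).subset ?_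
      rintro _ ⟨i, hi, rfl⟩
      obtain ⟨p, hp, q, hq, heq, hlp, hlq⟩ := h2 i hi.1
      exact ⟨p, hmem i hi p hp hlp, q, hmem i hi q hq hlq, heq.symm⟩
    · intro i hi j hj hij
      rcases lt_trichotomy i j with h | h | h
      · exact absurd hij (h3 i hi.1 j hj.1 h)
      · exact h
      · exact absurd hij.symm (h3 j hj.1 i hi.1 h)
  refine (hK.biUnion hfin).subset fun i hi => ?_
  obtain ⟨k, hk, hik⟩ := hC i hi
  exact Set.mem_biUnion hk hik

end Ratio

/-! ### Termination of the loop -/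

section Loop

variable {k : Type*} [Field k] {n d : ℕ} {m : MonomialOrder (Fin n)}

/-- The invariant of the states that occur after the interreduction. -/
inductive StateInv (m : MonomialOrder (Fin n)) (O : ModuleOrder n d)
    (f : Fin d → MvPolynomial (Fin n) k) : State k n → List (SigPoly k n d) → Prop
  | loop (CPs : Set (JPair k n d)) (SG : List (SigPoly k n d)) (PSyz : Set (SigPoly k n d))
      (h : LoopInv m O f CPs SG PSyz) : StateInv m O f (.loop CPs SG PSyz) SG
  | reducing (CPs : Set (JPair k n d)) (SG : List (SigPoly k n d)) (PSyz : Set (SigPoly k n d))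
      (sp : SigPoly k n d) (T : Sgn n d) (h : RedInv m O f CPs SG PSyz sp T) :
      StateInv m O f (.reducing CPs SG PSyz sp) SG

lemma StateInv.unique {O : ModuleOrder n d} {f : Fin d → MvPolynomial (Fin n) k} {S : State k n}
    {SG SG' : List (SigPoly k n d)} (h : StateInv m O f S SG) (h' : StateInv m O f S SG') :
    SG = SG' := by
  cases h <;> cases h' <;> rfl

lemma StateInv.base {O : ModuleOrder n d} {f : Fin d → MvPolynomial (Fin n) k} {S : State k n}
    {SG : List (SigPoly k n d)} (h : StateInv m O f S SG) :
    ∃ CPs PSyz, BaseInv m O f CPs SG PSyz := by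
  cases h with
  | loop CPs _ PSyz h => exact ⟨CPs, PSyz, h.toBaseInv⟩
  | reducing CPs _ PSyz _ _ h => exact ⟨CPs, PSyz, h.toBaseInv⟩

/-- A measure that decreases in all steps that do not enlarge the set of polynomials. -/
noncomputable def State.rank (m : MonomialOrder (Fin n)) :
    State k n → ℕ ×ₗ WithBot (WithBot m.syn)
  | .loop CPs _ _ => toLex (CPs.ncard, ⊥)
  | .reducing CPs _ _ sp => toLex (CPs.ncard, (leadSyn m sp.2 : WithBot (WithBot m.syn)))
  | _ => toLex (0, ⊥)

variable {O : ∀ d : ℕ, ModuleOrder n d}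

/-- Insertions of nonzero polynomials, which `finite_of_ratio` will bound, are separated here from
the steps that lower the rank. -/
lemma StateInv.step (hO : (O d).Compatible m) {f : Fin d → MvPolynomial (Fin n) k}
    {S S' : State k n} {SG : List (SigPoly k n d)} (h : StateInv m (O d) f S SG)
    (hs : Step m O S S') :
    (∃ G, S' = .output G ∧ IsGroebnerBasis m G (Ideal.span (Set.range f))) ∨
    ∃ SG', StateInv m (O d) f S' SG' ∧
      ((SG ⊆ SG' ∧ (∀ b ∈ SG', b ∈ SG ∨ b.2 = 0) ∧ S'.rank m < S.rank m) ∨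
        ∃ sp T, Fresh m (O d) SG sp T ∧
          (∀ b ∈ SG, (∃ i, b = unitSig f i) ∨ ∀ s, HasSig (O d) b s → (O d).lt s T) ∧
          ∀ b, b ∈ SG' ↔ b = sp ∨ b ∈ SG) := by
  cases h with
  | loop CPs SG PSyz h =>
    cases hs with
    | discard _ _ _ cp hmin hr =>
      refine Or.inr ⟨SG, .loop _ _ _ (h.discard hmin.1 hr), Or.inl ⟨fun _ => id,
        fun _ => Or.inl, ?_⟩⟩
      exact Prod.Lex.toLex_lt_toLex.2 (Or.inl (Set.ncard_sdiff_singleton_lt_of_mem hmin.1 h.finite))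
    | select _ _ _ cp hmin hts hF5 =>
      obtain ⟨T, hT⟩ := h.select hmin
      refine Or.inr ⟨SG, .reducing _ _ _ _ T hT, Or.inl ⟨fun _ => id, fun _ => Or.inl, ?_⟩⟩
      exact Prod.Lex.toLex_lt_toLex.2 (Or.inl (Set.ncard_sdiff_singleton_lt_of_mem hmin.1 h.finite))
    | halt => exact Or.inl ⟨_, rfl, h.isGroebnerBasis⟩
  | reducing CPs SG PSyz sp T h =>
    cases hs with
    | tmReduce _ _ _ _ sp' hr =>
      refine Or.inr ⟨SG, .reducing _ _ _ _ T (h.tmReduce hr), Or.inl ⟨fun _ => id,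
        fun _ => Or.inl, ?_⟩⟩
      exact Prod.Lex.toLex_lt_toLex.2 (Or.inr ⟨rfl, WithBot.coe_lt_coe.2 hr.leadSyn_lt⟩)
    | insertSyzygy _ _ SG' _ _ hsp hins =>
      refine Or.inr ⟨SG', .loop _ _ _ (h.insertSyzygy hsp hins), Or.inl
        ⟨hins.sublist.subset, fun b hb => ?_, ?_⟩⟩
      · exact (hins.mem_iff.1 hb).symm.imp_right fun he : b = sp => he ▸ hsp
      -- The outer `⊥` of a loop state lies below even the inner `⊥` that stands for the zero
      -- polynomial.
      · exact Prod.Lex.toLex_lt_toLex.2 (Or.inr ⟨rfl, WithBot.bot_lt_coe _⟩)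
    | insert _ _ SG' _ PSyz' _ hirr hsp hins hP =>
      exact Or.inr ⟨SG', .loop _ _ _ (h.insert hirr hins hP.1), Or.inr ⟨sp, T, h.fresh hO hirr hsp,
        h.lt_sig, fun b => hins.mem_iff⟩⟩

lemma StateInv.exists_step {f : Fin d → MvPolynomial (Fin n) k} {S : State k n}
    {SG : List (SigPoly k n d)} (h : StateInv m (O d) f S SG) : ∃ S', Step m O S S' := by
  cases h with
  | loop CPs SG PSyz h =>
    rcases CPs.eq_empty_or_nonempty with rfl | hne
    · exact ⟨_, .halt _ _⟩
    obtain ⟨cp, hmin⟩ := h.exists_isMinJPair hne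
    by_cases hr : TsRewritable m (O d) PSyz cp.toSigPoly ∨ F5Rewritable (O d) SG cp
    · exact ⟨_, .discard _ _ _ cp hmin hr⟩
    · rw [not_or] at hr
      exact ⟨_, .select _ _ _ cp hmin hr.1 hr.2⟩
  | reducing CPs SG PSyz sp T h =>
    obtain ⟨SG', hins⟩ := exists_insertByIndex h.sp_sig h.unit_mem
    by_cases hsp : sp.2 = 0
    · exact ⟨_, .insertSyzygy _ _ _ _ _ hsp hins⟩
    by_cases hirr : ∀ sp', ¬ TmReduces m (O d) {b | b ∈ SG} sp sp'
    · obtain ⟨P, hP⟩ := exists_superReduced (O := O d)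
        (N := PSyz ∪ {z | ∃ b ∈ SG', b.2 ≠ 0 ∧ z = principalSyzygy b sp}) (by
          rintro z (hz | ⟨b, -, -, rfl⟩)
          exacts [(h.syz z hz).2, rfl])
      exact ⟨_, .insert _ _ _ _ _ _ hirr hsp hins hP⟩
    · push Not at hirr
      obtain ⟨sp', hr⟩ := hirr
      exact ⟨_, .tmReduce _ _ _ _ _ hr⟩

lemma not_step_output {G : Set (MvPolynomial (Fin n) k)} {S : State k n} :
    ¬ Step m O (.output G) S := fun h => by cases h

theorem StateInv.not_infinite (hO : (O d).Compatible m) {f : Fin d → MvPolynomial (Fin n) k}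
    (S : ℕ → State k n) (SG₀ : List (SigPoly k n d)) (h0 : StateInv m (O d) f (S 0) SG₀)
    (hS : ∀ i, Step m O (S i) (S (i + 1))) : False := by
  have hall : ∀ i, ∃ SG, StateInv m (O d) f (S i) SG := by
    intro i
    induction i with
    | zero => exact ⟨_, h0⟩
    | succ i ih =>
      obtain ⟨SG, hSG⟩ := ih
      rcases hSG.step hO (hS i) with ⟨G, hG, -⟩ | ⟨SG', h', -⟩
      · exact absurd (hG ▸ hS (i + 1)) not_step_output
      · exact ⟨SG', h'⟩
  choose SG hSG using hall
  let Ins : ℕ → SigPoly k n d → Sgn n d → Prop := fun i sp T => Fresh m (O d) (SG i) sp T ∧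
    (∀ b ∈ SG i, (∃ i, b = unitSig f i) ∨ ∀ s, HasSig (O d) b s → (O d).lt s T) ∧
    ∀ b, b ∈ SG (i + 1) ↔ b = sp ∨ b ∈ SG i
  let I : Set ℕ := {i | ∃ sp T, Ins i sp T}
  have hstep : ∀ i, (SG i ⊆ SG (i + 1) ∧ (∀ b ∈ SG (i + 1), b ∈ SG i ∨ b.2 = 0) ∧
      (S (i + 1)).rank m < (S i).rank m) ∨ i ∈ I := by
    intro i
    rcases (hSG i).step hO (hS i) with ⟨G, hG, -⟩ | ⟨SG', h', h⟩
    · exact absurd (hG ▸ hS (i + 1)) not_step_output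
    · rw [h'.unique (hSG (i + 1))] at h
      exact h
  have hI : I.Finite := by
    -- A module monomial is needed as a default value for steps outside `I`; without any, `I` is
    -- empty.
    rcases isEmpty_or_nonempty (Sgn n d) with he | he
    · rw [Set.eq_empty_of_forall_notMem (s := I) fun i ⟨_, T, _⟩ => he.false T]
      exact Set.finite_empty
    have hne : ∀ i, ∃ y : SigPoly k n d × Sgn n d, i ∈ I → Ins i y.1 y.2 := by
      intro i
      by_cases hi : i ∈ I
      · obtain ⟨sp, T, h⟩ := hi
        exact ⟨(sp, T), fun _ => h⟩
      · exact ⟨(0, he.some), fun h => absurd h hi⟩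
    choose y hy using hne
    have hmono : ∀ i j, i ≤ j → SG i ⊆ SG j := by
      intro i j hij
      induction hij with
      | refl => exact fun _ => id
      | step _ ih =>
        rcases hstep _ with h | h
        · exact fun b hb => h.1 (ih hb)
        · exact fun b hb => ((hy _ h).2.2 b).2 (Or.inr (ih hb))
    have hmem : ∀ j, ∀ b ∈ SG j, b.2 ≠ 0 → b ∈ SG 0 ∨ ∃ i ∈ I, b = (y i).1 := by
      intro j
      induction j with
      | zero => exact fun b hb _ => Or.inl hb
      | succ j ih =>
        intro b hb hb0
        rcases hstep j with h | h
        · exact ih b ((h.2.1 b hb).resolve_right hb0) hb0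
        · rcases ((hy j h).2.2 b).1 hb with he | hb
          · exact Or.inr ⟨j, h, he⟩
          · exact ih b hb hb0
    let x : ℕ → Sgn n d × Mon n := fun i => ((y i).2, m.degree (y i).1.2)
    -- Data of the elements present at the start, which may also serve as parents of new elements.
    let D : Set (Sgn n d × Mon n) := {z | ∃ b ∈ SG 0, HasSig (O d) b z.1 ∧ z.2 = m.degree b.2}
    have hD : D.Finite := by
      have hfin : {b | b ∈ SG 0}.Finite := List.finite_toSet _
      refine (hfin.biUnion (t := fun b => {z : Sgn n d × Mon n |
        HasSig (O d) b z.1 ∧ z.2 = m.degree b.2}) fun b _ => ?_).subset ?_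
      · refine Set.Subsingleton.finite fun z hz z' hz' => Prod.ext (hz.1.unique hz'.1) ?_
        rw [hz.2, hz'.2]
      · rintro z ⟨b, hb, hz⟩
        exact Set.mem_biUnion hb hz
    have hdata : ∀ j, ∀ b ∈ SG j, b.2 ≠ 0 → ∀ s, HasSig (O d) b s →
        ((s, m.degree b.2) : Sgn n d × Mon n) ∈ D ∪ x '' I := by
      intro j b hb hb0 s hs
      rcases hmem j b hb hb0 with h | ⟨i, hi, rfl⟩
      · exact Or.inl ⟨b, h, hs, rfl⟩
      · exact Or.inr ⟨i, hi, Prod.ext ((hy i hi).1.hasSig.unique hs) rfl⟩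
    have hlater : ∀ i ∈ I, ∀ j, i < j → (y i).1 ∈ SG j := fun i hi j hij =>
      hmono _ _ hij (((hy i hi).2.2 _).2 (Or.inl rfl))
    refine finite_of_ratio (O d) I x D hD ?_ ?_ ?_
    · intro i hi j hj hij t t' ht ht'
      exact (hy j hj).1.ratio_eq _ (hlater i hi j hij) (hy i hi).1.ne_zero _ t t'
        (hy i hi).1.hasSig ht ht'
    · intro j hj
      obtain ⟨a, ha, b, hb, ha0, hb0, s, s', hs, hs', hT, hlt, hlt'⟩ := (hy j hj).1.origin
      exact ⟨_, hdata j a ha ha0 s hs, _, hdata j b hb hb0 s' hs', hT, hlt, hlt'⟩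
    · intro i hi j hj hij he
      -- The element inserted at step `i` is not initial, since it was new to the list. So its
      -- signature lies below that of step `j`.
      rcases (hy j hj).2.1 _ (hlater i hi j hij) with ⟨l, hl⟩ | h
      · obtain ⟨_, _, hb⟩ := (hSG i).base
        exact (hy i hi).1.notMem (hl ▸ hb.unit_mem l)
      · have := h _ (hy i hi).1.hasSig
        change (y i).2 = (y j).2 at he
        rw [he] at this
        exact ModuleOrder.lt_irrefl _ this
  -- Beyond the last index in `I`, the rank would decrease forever.
  obtain ⟨N, hN⟩ := hI.bddAbove
  obtain ⟨i, hi⟩ := WellFounded.not_rel_apply_succ (r := (· < ·)) fun i => (S (N + 1 + i)).rank m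
  refine hi ?_
  rcases hstep (N + 1 + i) with h | h
  · exact h.2.2
  · have := hN h
    omega

end Loop

/-! ### Interreduction -/

section Interreduction

variable {k : Type*} [Field k] {n : ℕ} {m : MonomialOrder (Fin n)}

/-- The multiset of all monomials of a list of polynomials. -/
noncomputable def monomials (m : MonomialOrder (Fin n)) (L : List (MvPolynomial (Fin n) k)) :
    Multiset m.syn :=
  (L.map fun p => p.support.val.map m.toSyn).sum

/-- The monomial `a` disappears, and every monomial that newly appears comes from the subtracted
multiple of `g`, whose leading monomial is `a`. -/
lemma isDershowitzMannaLT_reduce {p g : MvPolynomial (Fin n) k} (hg : g ≠ 0) {a : Mon n}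
    (ha : coeff a p ≠ 0) (hdvd : m.degree g ≤ a) (M : Multiset m.syn) :
    Multiset.IsDershowitzMannaLT
      (M + (p - monomial (a - m.degree g) (coeff a p / m.leadingCoeff g) * g).support.val.map
        m.toSyn)
      (M + p.support.val.map m.toSyn) := by
  classical
  have hlg := m.leadingCoeff_ne_zero_iff.2 hg
  set q := monomial (a - m.degree g) (coeff a p / m.leadingCoeff g) * g with hq
  have hqdeg : m.degree q = a := by
    rw [hq, degree_monomial_mul (div_ne_zero ha hlg) hg, tsub_add_cancel_of_le hdvd]
  have hcoeff : coeff a (p - q) = 0 := by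
    have h1 : coeff a q = coeff a p / m.leadingCoeff g * m.leadingCoeff g := by
      rw [hq, MonomialOrder.leadingCoeff, ← coeff_monomial_mul _ (a - m.degree g),
        tsub_add_cancel_of_le hdvd]
    rw [coeff_sub, h1, div_mul_cancel₀ _ hlg, sub_self]
  have hsplit : ∀ A B : Finset (Mon n), A.val.map m.toSyn =
      (A ∩ B).val.map m.toSyn + (A \ B).val.map m.toSyn := by
    intro A B
    rw [← Multiset.map_add, ← Finset.disjUnion_val _ _ (Finset.disjoint_sdiff_inter A B).symm,
      Finset.disjUnion_eq_union, Finset.union_comm, Finset.sdiff_union_inter]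
  have ha' : a ∈ p.support \ (p - q).support := by simp [ha, hcoeff]
  refine ⟨M + (p.support ∩ (p - q).support).val.map m.toSyn,
    ((p - q).support \ p.support).val.map m.toSyn,
    (p.support \ (p - q).support).val.map m.toSyn, ?_, ?_, ?_, ?_⟩
  · intro h0
    rw [Multiset.empty_eq_zero, Multiset.map_eq_zero, Finset.val_eq_zero] at h0
    simp [h0] at ha'
  · rw [add_assoc, Finset.inter_comm, ← hsplit]
  · rw [add_assoc, ← hsplit]
  · intro y hy
    obtain ⟨b, hb, rfl⟩ := Multiset.mem_map.1 hy
    refine ⟨m.toSyn a, Multiset.mem_map_of_mem _ ha', ?_⟩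
    rw [Finset.mem_val, Finset.mem_sdiff, notMem_support_iff] at hb
    obtain ⟨hb1, hb2⟩ := hb
    have hbq : b ∈ q.support := by
      rw [mem_support_iff, coeff_sub, hb2, zero_sub, neg_ne_zero] at hb1
      exact mem_support_iff.2 hb1
    refine lt_of_le_of_ne (hqdeg ▸ m.le_degree hbq) fun heq => ha ?_
    rwa [← m.toSyn.injective heq]

/-- Compare lengths first, then multisets of monomials: removing a zero shortens the list, and a
reduction keeps the length. -/
lemma wellFounded_interStep (m : MonomialOrder (Fin n)) :
    WellFounded fun L' L : List (MvPolynomial (Fin n) k) => InterStep m L L' := by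
  have hwf := WellFounded.prod_lex (wellFounded_lt (α := ℕ))
    (Multiset.wellFounded_isDershowitzMannaLT (α := m.syn))
  refine Subrelation.wf ?_ (InvImage.wf
    (fun L : List (MvPolynomial (Fin n) k) => (L.length, monomials m L)) hwf)
  intro L' L h
  cases h with
  | dropZero i hi =>
    refine Prod.Lex.left _ _ ?_
    have := List.length_eraseIdx_add_one i.2
    omega
  | reduce i j hij hj a ha hdvd =>
    have key : ∀ p', monomials m (L.set i p') =
        monomials m (L.take i) + monomials m (L.drop (i + 1)) + p'.support.val.map m.toSyn := by
      intro p'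
      rw [List.set_eq_take_append_cons_drop, if_pos i.2]
      simp only [monomials, List.map_append, List.map_cons, List.sum_append, List.sum_cons]
      abel
    have hL : L.set i (L.get i) = L := List.set_getElem_self i.2
    simp only [InvImage]
    rw [List.length_set]
    refine Prod.Lex.right _ ?_
    have h2 := isDershowitzMannaLT_reduce hj ha hdvd
      (monomials m (L.take i) + monomials m (L.drop (i + 1)))
    rw [← key, ← key, hL] at h2
    exact h2

/-- The reducing entry stays in the list, so a reduction can be undone by adding back its multiple.
-/
lemma InterStep.span_eq {L L' : List (MvPolynomial (Fin n) k)} (h : InterStep m L L') :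
    Ideal.span {p | p ∈ L'} = Ideal.span {p | p ∈ L} := by
  cases h with
  | dropZero i hi =>
    refine le_antisymm (Ideal.span_mono fun p hp => List.mem_of_mem_eraseIdx hp) ?_
    refine Ideal.span_le.2 fun p hp => ?_
    by_cases h0 : p = 0
    · rw [h0]
      exact Ideal.zero_mem _
    · obtain ⟨l, hl, rfl⟩ := List.mem_iff_getElem.1 hp
      refine Ideal.subset_span (List.mem_eraseIdx_iff_getElem.2 ⟨l, hl, ?_, rfl⟩)
      rintro rfl
      exact h0 hi
  | reduce i j hij hj a ha hdvd =>
    set q := monomial (a - m.degree (L.get j)) (coeff a (L.get i) / m.leadingCoeff (L.get j))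
    set L' := L.set i (L.get i - q * L.get j) with hL'
    have hjL' : L.get j ∈ L' := by
      refine List.mem_iff_getElem.2 ⟨j, by simp [hL'], ?_⟩
      exact List.getElem_set_ne (fun h => hij (Fin.ext h)) _
    have hiL' : L.get i - q * L.get j ∈ L' := List.mem_set i.2 _
    refine le_antisymm (Ideal.span_le.2 fun p hp => ?_) (Ideal.span_le.2 fun p hp => ?_)
    · rcases List.mem_or_eq_of_mem_set hp with hp | rfl
      · exact Ideal.subset_span hp
      · exact Ideal.sub_mem _ (Ideal.subset_span (L.get_mem i))
          (Ideal.mul_mem_left _ _ (Ideal.subset_span (L.get_mem j)))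
    · obtain ⟨l, hl, rfl⟩ := List.mem_iff_getElem.1 hp
      by_cases hli : (i : ℕ) = l
      · subst hli
        have := Ideal.add_mem _ (Ideal.subset_span (s := {p | p ∈ L'}) hiL')
          (Ideal.mul_mem_left _ q (Ideal.subset_span (s := {p | p ∈ L'}) hjL'))
        rwa [sub_add_cancel] at this
      · refine Ideal.subset_span (List.mem_iff_getElem.2 ⟨l, by simpa [hL'] using hl, ?_⟩)
        exact List.getElem_set_ne hli _

lemma exists_sortedOf (m : MonomialOrder (Fin n)) (L : List (MvPolynomial (Fin n) k)) :
    ∃ L', SortedOf m L L' := by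
  classical
  let r : MvPolynomial (Fin n) k → MvPolynomial (Fin n) k → Prop :=
    fun p q => m.toSyn (m.degree p) ≤ m.toSyn (m.degree q)
  have : Std.Total r := ⟨fun p q => le_total _ _⟩
  have : IsTrans _ r := ⟨fun _ _ _ => le_trans⟩
  exact ⟨L.insertionSort r, List.perm_insertionSort r L, List.pairwise_insertionSort r L⟩

/-! ### Runs of the algorithm -/

/-- The invariant of all states that are reached from the input `F`. -/
inductive RunInv (m : MonomialOrder (Fin n)) (O : ∀ d : ℕ, ModuleOrder n d)
    (F : List (MvPolynomial (Fin n) k)) : State k n → Prop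
  | interreducing (L : List (MvPolynomial (Fin n) k))
      (h : Ideal.span {p | p ∈ L} = Ideal.span {p | p ∈ F}) : RunInv m O F (.interreducing L)
  | loop {d : ℕ} (f : Fin d → MvPolynomial (Fin n) k) (S : State k n)
      (SG : List (SigPoly k n d)) (h : StateInv m (O d) f S SG)
      (hf : Ideal.span (Set.range f) = Ideal.span {p | p ∈ F}) : RunInv m O F S
  | output (G : Set (MvPolynomial (Fin n) k))
      (h : IsGroebnerBasis m G (Ideal.span {p | p ∈ F})) : RunInv m O F (.output G)

variable {O : ∀ d : ℕ, ModuleOrder n d} {F : List (MvPolynomial (Fin n) k)}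

lemma RunInv.step (hO : ∀ d : ℕ, (O d).Compatible m) {S S' : State k n} (h : RunInv m O F S)
    (hs : Step m O S S') : RunInv m O F S' := by
  cases h with
  | interreducing L h =>
    cases hs with
    | interreduce _ L' h' => exact .interreducing _ (h'.span_eq.trans h)
    | init _ L' hL hsort =>
      refine .loop L'.get _ _ (.loop _ _ _ (LoopInv.init m (O L'.length) L'.get)) ?_
      rw [← h, Set.range_list_get]
      congr 1
      ext p
      exact hsort.1.mem_iff
  | loop f _ SG h hf =>
    rcases h.step (hO _) hs with ⟨G, rfl, hG⟩ | ⟨SG', h', -⟩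
    · exact .output G (hf ▸ hG)
    · exact .loop f _ SG' h' hf
  | output => exact absurd hs not_step_output

lemma RunInv.exists_step {S : State k n} (h : RunInv m O F S) :
    (∃ G, S = .output G) ∨ ∃ S', Step m O S S' := by
  cases h with
  | interreducing L h =>
    right
    by_cases hL : ∃ L', InterStep m L L'
    · obtain ⟨L', hL'⟩ := hL
      exact ⟨_, .interreduce _ _ hL'⟩
    · obtain ⟨L', hL'⟩ := exists_sortedOf m L
      exact ⟨_, .init L L' (not_exists.1 hL) hL'⟩
  | loop f _ SG h hf => exact Or.inr h.exists_step
  | output G => exact Or.inl ⟨G, rfl⟩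

lemma RunInv.of_reflTransGen (hO : ∀ d : ℕ, (O d).Compatible m) {S : State k n}
    (h : Relation.ReflTransGen (Step m O) (.interreducing F) S) : RunInv m O F S := by
  induction h with
  | refl => exact .interreducing F rfl
  | tail _ hs ih => exact ih.step hO hs

/-- An infinite run either never leaves the interreduction, or has an infinite tail inside the loop,
since an output admits no further step. -/
theorem not_infinite_run (hO : ∀ d : ℕ, (O d).Compatible m) (S : ℕ → State k n)
    (h0 : S 0 = .interreducing F) (hS : ∀ i, Step m O (S i) (S (i + 1))) : False := by
  have hinv : ∀ i, RunInv m O F (S i) := by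
    intro i
    induction i with
    | zero => exact h0 ▸ .interreducing F rfl
    | succ i ih => exact ih.step hO (hS i)
  by_cases hall : ∀ i, ∃ L, S i = .interreducing L
  · choose L hL using hall
    have : IsWellFounded _ fun L' L : List (MvPolynomial (Fin n) k) => InterStep m L L' :=
      ⟨wellFounded_interStep m⟩
    obtain ⟨i, hi⟩ := WellFounded.not_rel_apply_succ
      (r := fun L' L : List (MvPolynomial (Fin n) k) => InterStep m L L') L
    have := hS i
    rw [hL, hL] at this
    cases this with
    | interreduce _ _ h => exact hi h
  · push Not at hall
    obtain ⟨i, hi⟩ := hall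
    have h := hinv i
    generalize hSi : S i = Si at h
    cases h with
    | interreducing L => exact hi L hSi
    | loop f _ SG h hf =>
      subst hSi
      exact StateInv.not_infinite (hO _) (fun j => S (i + j)) SG h fun j => hS (i + j)
    | output G => exact not_step_output (hSi ▸ hS i)

end Interreduction

end F5B

theorem mainTheorem4 {k : Type*} [Field k] {n : ℕ} (m : MonomialOrder (Fin n))
    (O : ∀ d : ℕ, F5B.ModuleOrder n d) (hO : ∀ d : ℕ, (O d).Compatible m)
    (F : List (MvPolynomial (Fin n) k)) :
    (¬ ∃ S : ℕ → F5B.State k n,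
        S 0 = F5B.State.interreducing F ∧ ∀ i : ℕ, F5B.Step m O (S i) (S (i + 1))) ∧
    (∀ S : F5B.State k n,
        Relation.ReflTransGen (F5B.Step m O) (F5B.State.interreducing F) S →
        (∀ S' : F5B.State k n, ¬ F5B.Step m O S S') →
        ∃ G : Set (MvPolynomial (Fin n) k), S = F5B.State.output G) ∧
    (∀ G : Set (MvPolynomial (Fin n) k),
        Relation.ReflTransGen (F5B.Step m O) (F5B.State.interreducing F)
          (F5B.State.output G) →
        F5B.IsGroebnerBasis m G (Ideal.span {f | f ∈ F})) := by
  refine ⟨?_, ?_, ?_⟩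
  · rintro ⟨S, h0, hS⟩
    exact F5B.not_infinite_run hO S h0 hS
  · intro S hS hstuck
    refine (F5B.RunInv.of_reflTransGen hO hS).exists_step.resolve_right ?_
    rintro ⟨S', h⟩
    exact hstuck S' h
  · intro G hG
    generalize hS : F5B.State.output G = S at hG
    have h := F5B.RunInv.of_reflTransGen hO hG
    cases h with
    | interreducing L => cases hS
    | loop f _ SG h => subst hS; cases h
    | output G' h => cases hS; exact h
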